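/- **Definitions.** Let $\mathbb F$ be an arbitrary field. For a Lie algebra $\mathcal L$ over $\mathbb F$ with centre $Z(\mathcal L)$, the commuting graph $\Gamma(\mathcal L)$ is the simple graph with vertex set $\mathcal L\setminus Z(\mathcal L)$ in which two distinct vertices $x,y$ are adjacent iff $[x,y]=0$; $\mathrm{CC}_{\mathbb F}(\mathcal L)$ is the set of its connected components (as induced subgraphs). $\langle\cdots\rangle$ is linear span over $\mathbb F$; $S^\#$ is the set of nonzero elements of $S$; $K_S$ is the complete graph on the vertex set $S$; a union of graphs has the union of the vertex sets and the union of the edge sets. For sets $S,U$ and a cardinal $t$, $W(K_S,U,t)$ is the graph (up to isomorphism) obtained from $t$ disjoint copies of $K_S$ and one copy of $K_U$ by joining every vertex of every copy of $K_S$ to every vertex of $K_U$. Let $\mathcal N$ be one of the following Lie algebras with basis $e_1,e_2,e_3,e_4$ over $\mathbb F$ (de Graaf's list of the noncommutative solvable Lie algebras of dimension $4$; brackets of basis vectors that do not follow from the listed ones by antisymmetry are zero; $\alpha,\beta\in\mathbb F$): - $\mathcal N_{4,1}$: $[e_4,e_1]=e_1$, $[e_4,e_2]=e_2$, $[e_4,e_3]=e_3$.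 - $\mathcal N_{4,2,\alpha}$: $[e_4,e_1]=e_1$, $[e_4,e_2]=e_3$, $[e_4,e_3]=-\alpha e_2+(\alpha+1)e_3$. - $\mathcal N_{4,3}$: $[e_4,e_2]=e_3$, $[e_4,e_3]=e_3$. - $\mathcal N_{4,4}$: $[e_4,e_2]=e_3$. - $\mathcal N_{4,5,\alpha,\beta}$: $[e_4,e_1]=e_2$, $[e_4,e_2]=e_3$, $[e_4,e_3]=\alpha e_1+\beta e_2+e_3$. - $\mathcal N_{4,6,\alpha,\beta}$: $[e_4,e_1]=e_2$, $[e_4,e_2]=e_3$, $[e_4,e_3]=\alpha e_1+\beta e_2$. - $\mathcal N_{4,7}$: $[e_1,e_2]=e_2$, $[e_3,e_4]=e_4$. - $\mathcal N_{4,8,\alpha}$ ($T^2-T-\alpha$ has no root in $\mathbb F$): $[e_4,e_1]=e_1+\alpha e_2$, $[e_4,e_2]=e_1$, $[e_3,e_1]=e_1$, $[e_3,e_2]=e_2$. - $\mathcal N_{4,9,\alpha}$ ($\operatorname{char}\mathbb F=2$, $\alpha$ not a square in $\mathbb F$): $[e_4,e_1]=e_2$, $[e_4,e_2]=\alpha e_1$,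 $[e_3,e_1]=e_1$, $[e_3,e_2]=e_2$. - $\mathcal N_{4,10,\alpha,\beta}$ ($\operatorname{char}\mathbb F=2$, $\alpha\ne0$, $\beta\ne1$): $[e_4,e_1]=e_1$, $[e_3,e_1]=e_2$, $[e_3,e_2]=\alpha e_1$, $[e_4,e_2]=\beta e_2$, $[e_4,e_3]=(1+\beta)e_3$. - $\mathcal N_{4,11}$: $[e_4,e_1]=e_1$, $[e_3,e_1]=e_2$, $[e_4,e_2]=2e_2$, $[e_4,e_3]=e_3$. - $\mathcal N_{4,12,\alpha}$: $[e_3,e_1]=e_2$, $[e_4,e_1]=e_1+\alpha e_3$, $[e_4,e_2]=e_2$, $[e_4,e_3]=e_1$. - $\mathcal N_{4,13,\alpha}$ ($\alpha\ne0$): $[e_3,e_1]=e_2$, $[e_4,e_1]=\alpha e_3$, $[e_4,e_3]=e_1$. **Theorem.** The set $\mathrm{CC}_{\mathbb F}(\mathcal N)$ consists of the graphs listed below, where $\mu_1,\mu_2,\mu_3,\mu_4$ run over $\mathbb F$ (repetitions are possible within a list). If $\mathbb F=\mathbb F_q$ is finite with $q$ elements, then $|\mathrm{CC}_{\mathbb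 F}(\mathcal N)|$ is the number at the end of each item (where an algebra of the item exists over $\mathbb F_q$). 1. $\mathcal N_{4,1}$; $\mathcal N_{4,2,\alpha}$ with $\alpha\neq0$; $\mathcal N_{4,5,\alpha,\beta}$ with $\alpha\ne0$; $\mathcal N_{4,6,\alpha,\beta}$ with $\alpha\neq 0$: $K_{\langle e_1,e_2,e_3\rangle^\#}$ and $K_{\langle \mu_1e_1+\mu_2e_2+\mu_3e_3+e_4\rangle^\#}$; $q^3+1$. 2. $\mathcal N_{4,2,0}$: $K_{\langle e_1,e_3\rangle^\#+\langle e_2-e_3\rangle}$ and $K_{\langle\mu_1e_1+\mu_3e_3+e_4\rangle^\#+\langle e_2-e_3\rangle}$; $q^2+1$. 3. $\mathcal N_{4,3}$: $K_{\langle e_3\rangle^\#+\langle e_1,e_2-e_3\rangle}$ and $K_{\langle\mu_3e_3+e_4\rangle^\#+\langle e_1,e_2-e_3\rangle}$; $q+1$. 4. $\mathcal N_{4,4}$: $K_{\langle e_2\rangle^\#+\langle e_1,e_3\rangle}$ and $K_{\langle\mu_2e_2+e_4\rangle^\#+\langle e_1,e_3\rangle}$; $q+1$. 5. $\mathcal N_{4,5,0,0}$: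 $K_{\langle e_1,e_2\rangle^\#+\langle e_2-e_3\rangle}$ and $K_{\langle\mu_1e_1+\mu_2e_2+e_4\rangle^\#+\langle e_2-e_3\rangle}$; $q^2+1$. 6. $\mathcal N_{4,5,0,\beta}$, $\beta\ne0$: $K_{\langle e_2,e_3\rangle^\#+\langle\beta e_1+e_2-e_3\rangle}$ and $K_{\langle\mu_2e_2+\mu_3e_3+e_4\rangle^\#+\langle\beta e_1+e_2-e_3\rangle}$; $q^2+1$. 7. $\mathcal N_{4,6,0,0}$: $K_{\langle e_1,e_2\rangle^\#+\langle e_3\rangle}$ and $K_{\langle\mu_1e_1+\mu_2e_2+e_4\rangle^\#+\langle e_3\rangle}$; $q^2+1$. 8. $\mathcal N_{4,6,0,\beta}$, $\beta\ne0$: $K_{\langle e_2,e_3\rangle^\#+\langle\beta e_1-e_3\rangle}$ and $K_{\langle\mu_2e_2+\mu_3e_3+e_4\rangle^\#+\langle\beta e_1-e_3\rangle}$; $q^2+1$. 9. $\mathcal N_{4,7}$: the single component $\bigcup_{(\mu_1,\mu_2,\mu_3,\mu_4)\ne 0}K_{(\langle\mu_1e_1+\mu_2e_2\rangle+\langle\mu_3e_3+\mu_4e_4\rangle)^\#}$;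 $1$. 10. $\mathcal N_{4,8,\alpha}$: $K_{\langle e_1,e_2\rangle^\#}$, $K_{\langle e_3,e_4\rangle^\#}$ and $K_{\langle e_1+\mu_3e_3+\mu_4e_4,\; e_2+(\mu_4-\frac{\mu_3}{\alpha})e_3+\frac{\mu_3}{\alpha}e_4\rangle^\#}$; $q^2+1$. 11. $\mathcal N_{4,9,\alpha}$: $K_{\langle e_1,e_2\rangle^\#}$, $K_{\langle e_3,e_4\rangle^\#}$ and $K_{\langle e_1+\mu_3e_3+\mu_4e_4,\; e_2+\alpha\mu_4e_3+\mu_3e_4\rangle^\#}$; $q^2+1$ (this algebra does not exist over a finite field). 12. $\mathcal N_{4,10,\alpha,\beta}$ with $\alpha\beta$ not a square in $\mathbb F$: $K_{\langle e_1,e_2\rangle^\#}$, $K_{\langle\mu_1e_1+\mu_2e_2+e_3\rangle^\#}$ and $K_{\langle\mu_1e_1+\mu_2e_2+\mu_3e_3+e_4\rangle^\#}$; $q^3+q^2+1$ (this case does not occur over a finite field). 13. $\mathcal N_{4,10,\alpha,\beta}$ with $\alpha\beta=\gamma^2$, $\gamma\in\mathbb F$: the union $K_{\langle e_1,e_2\rangle^\#}\cup\bigcup_{\mu_1,\mu_2\in\mathbb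 F}K_{(\langle\gamma e_1+e_2\rangle+\langle\mu_1e_1+\mu_2e_2+\gamma e_3+\alpha e_4\rangle)^\#}$ (one component), $K_{\langle\mu_1e_1+\mu_2e_2+e_3\rangle^\#}$, and $K_{\langle\mu_1e_1+\mu_2e_2+\mu_3e_3+e_4\rangle^\#}$ with $\alpha\mu_3^2\ne\beta$; $q^3+1$. 14. $\mathcal N_{4,11}$ with $\operatorname{char}\mathbb F=2$; $\mathcal N_{4,13,\alpha}$: $K_{\langle e_4\rangle^\#+\langle e_2\rangle}$, $K_{\langle e_3+\mu_4e_4\rangle^\#+\langle e_2\rangle}$ and $K_{\langle e_1+\mu_3e_3+\mu_4e_4\rangle^\#+\langle e_2\rangle}$; $q^2+q+1$. 15. $\mathcal N_{4,11}$ with $\operatorname{char}\mathbb F\ne2$; $\mathcal N_{4,12,\alpha}$ with $\alpha\ne0$: the subgraph of $\Gamma(\mathcal N)$ induced by $\langle e_1,e_2,e_3\rangle^\#$, which is a generalized windmill graph $W(K_{\langle e_1\rangle^\#+\langle e_2\rangle},\langle e_2\rangle^\#,|\mathbb F|+1)$, and $K_{\langle\mu_1e_1+\mu_2e_2+\mu_3e_3+e_4\rangle^\#}$;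 $q^3+1$. 16. $\mathcal N_{4,12,0}$: the single component $\Gamma(\mathcal N_{4,12,0})$; $1$. In particular, $\Gamma(\mathcal N)$ is connected if and only if $\mathcal N$ is $\mathcal N_{4,7}$ or $\mathcal N_{4,12,0}$. -/

import Mathlib

universe u

open scoped Pointwise
open Submodule (span)

namespace SolvLie

/-! ### Graphs with vertices in a given set, and windmill graphs -/

/-- A simple graph whose vertex set is a subset of `L`. -/
abbrev GraphIn (L : Type u) : Type u := SimpleGraph.Subgraph (⊤ : SimpleGraph L)

/-- The complete graph `K_S` on the vertex set `S`. -/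
def completeOn {L : Type u} (S : Set L) : GraphIn L where
  verts := S
  Adj x y := x ∈ S ∧ y ∈ S ∧ x ≠ y
  adj_sub h := h.2.2
  edge_vert h := h.1
  symm := ⟨fun _ _ h => ⟨h.2.1, h.1, h.2.2.symm⟩⟩

/-- The set of connected components of `G`, each one taken as the subgraph of `G` induced by
its vertex set. -/
def components {L : Type u} (G : GraphIn L) : Set (GraphIn L) :=
  {H | ∃ c : G.coe.ConnectedComponent, H = G.induce (Subtype.val '' c.supp)}

/-- The generalized windmill graph: copies of the complete graph `K_S`, indexed by `T`, all of
whose vertices are joined to every vertex of the complete graph `K_U`. Vertices in different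
copies of `K_S` are not adjacent. -/
def windmill (S U T : Type u) : SimpleGraph ((T × S) ⊕ U) where
  Adj x y := match x, y with
    | .inl a, .inl b => a.1 = b.1 ∧ a.2 ≠ b.2
    | .inl _, .inr _ => True
    | .inr _, .inl _ => True
    | .inr a, .inr b => a ≠ b
  symm := ⟨by
    rintro (a | a) (b | b) h
    · exact ⟨h.1.symm, h.2.symm⟩
    · trivial
    · trivial
    · exact Ne.symm h⟩
  loopless := ⟨by
    rintro (a | a) h
    · exact h.2 rfl
    · exact h rfl⟩

/-- `G` is the graph `W(K_S, U, t)`, made of `t` copies of `K_S` (up to isomorphism). -/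
def IsWindmill {V : Type u} (G : SimpleGraph V) (S U : Type u) (t : Cardinal.{u}) : Prop :=
  ∃ T : Type u, Cardinal.mk T = t ∧ Nonempty (G ≃g windmill S U T)

/-! ### Commuting graphs of Lie algebras -/

/-- The commuting graph: the vertices are the noncentral elements, and two distinct vertices
are adjacent if and only if they commute. -/
def commutingGraph (F L : Type u) [Field F] [LieRing L] [LieAlgebra F L] : GraphIn L where
  verts := {x | x ∉ LieAlgebra.center F L}
  Adj x y := x ∉ LieAlgebra.center F L ∧ y ∉ LieAlgebra.center F L ∧ x ≠ y ∧ ⁅x, y⁆ = 0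
  adj_sub h := h.2.2.1
  edge_vert h := h.1
  symm := ⟨fun x y h => ⟨h.2.1, h.1, h.2.2.1.symm, by rw [← lie_skew, h.2.2.2, neg_zero]⟩⟩

/-- The set `CC_F(L)` of connected components of the commuting graph of `L`. -/
def CC (F L : Type u) [Field F] [LieRing L] [LieAlgebra F L] : Set (GraphIn L) :=
  components (commutingGraph F L)

/-- The set of nonzero elements of a subspace. -/
def sharp {F L : Type u} [Field F] [AddCommGroup L] [Module F L] (W : Submodule F L) : Set L :=
  {x | x ∈ W ∧ x ≠ 0}

/-- The set `W^# + Z` of all sums of a nonzero element of `W` and an element of `Z`. -/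
def sharpAdd {F L : Type u} [Field F] [AddCommGroup L] [Module F L] (W Z : Submodule F L) :
    Set L :=
  sharp W + (Z : Set L)

/-! ### The noncommutative solvable Lie algebras of dimension 4 -/

/-- The list of noncommutative solvable Lie algebras of dimension 4 over `F`, with the
conditions on the parameters. -/
inductive Table (F : Type u) [Field F] : Type u
  | n1
  | n2 (α : F)
  | n3
  | n4
  | n5 (α β : F)
  | n6 (α β : F)
  | n7
  | n8 (α : F) (hα : ∀ T : F, T ^ 2 - T - α ≠ 0)
  | n9 (α : F) (h2 : CharP F 2) (hα : ∀ γ : F, α ≠ γ ^ 2)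
  | n10 (α β : F) (h2 : CharP F 2) (hα : α ≠ 0) (hβ : β ≠ 1)
  | n11
  | n12 (α : F)
  | n13 (α : F) (hα : α ≠ 0)

variable {F : Type u} [Field F]

/-- The listed brackets: `rel N i j` is the coordinate vector of `[e_{i+1}, e_{j+1}]` if that
bracket is listed for `N`, and `0` otherwise (indices start from `0` here). -/
def rel : Table F → Fin 4 → Fin 4 → Fin 4 → F
  | .n1 => fun
    | 3, 0 => ![1, 0, 0, 0]
    | 3, 1 => ![0, 1, 0, 0]
    | 3, 2 => ![0, 0, 1, 0]
    | _, _ => 0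
  | .n2 α => fun
    | 3, 0 => ![1, 0, 0, 0]
    | 3, 1 => ![0, 0, 1, 0]
    | 3, 2 => ![0, -α, α + 1, 0]
    | _, _ => 0
  | .n3 => fun
    | 3, 1 => ![0, 0, 1, 0]
    | 3, 2 => ![0, 0, 1, 0]
    | _, _ => 0
  | .n4 => fun
    | 3, 1 => ![0, 0, 1, 0]
    | _, _ => 0
  | .n5 α β => fun
    | 3, 0 => ![0, 1, 0, 0]
    | 3, 1 => ![0, 0, 1, 0]
    | 3, 2 => ![α, β, 1, 0]
    | _, _ => 0
  | .n6 α β => fun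
    | 3, 0 => ![0, 1, 0, 0]
    | 3, 1 => ![0, 0, 1, 0]
    | 3, 2 => ![α, β, 0, 0]
    | _, _ => 0
  | .n7 => fun
    | 0, 1 => ![0, 1, 0, 0]
    | 2, 3 => ![0, 0, 0, 1]
    | _, _ => 0
  | .n8 α _ => fun
    | 3, 0 => ![1, α, 0, 0]
    | 3, 1 => ![1, 0, 0, 0]
    | 2, 0 => ![1, 0, 0, 0]
    | 2, 1 => ![0, 1, 0, 0]
    | _, _ => 0
  | .n9 α _ _ => fun
    | 3, 0 => ![0, 1, 0, 0]
    | 3, 1 => ![α, 0, 0, 0]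
    | 2, 0 => ![1, 0, 0, 0]
    | 2, 1 => ![0, 1, 0, 0]
    | _, _ => 0
  | .n10 α β _ _ _ => fun
    | 3, 0 => ![1, 0, 0, 0]
    | 2, 0 => ![0, 1, 0, 0]
    | 2, 1 => ![α, 0, 0, 0]
    | 3, 1 => ![0, β, 0, 0]
    | 3, 2 => ![0, 0, 1 + β, 0]
    | _, _ => 0
  | .n11 => fun
    | 3, 0 => ![1, 0, 0, 0]
    | 2, 0 => ![0, 1, 0, 0]
    | 3, 1 => ![0, 2, 0, 0]
    | 3, 2 => ![0, 0, 1, 0]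
    | _, _ => 0
  | .n12 α => fun
    | 2, 0 => ![0, 1, 0, 0]
    | 3, 0 => ![1, 0, α, 0]
    | 3, 1 => ![0, 1, 0, 0]
    | 3, 2 => ![1, 0, 0, 0]
    | _, _ => 0
  | .n13 α _ => fun
    | 2, 0 => ![0, 1, 0, 0]
    | 3, 0 => ![0, 0, α, 0]
    | 3, 2 => ![1, 0, 0, 0]
    | _, _ => 0

/-- The structure constants: `[e_i, e_j]`, as determined by the listed brackets and
antisymmetry, all other brackets of basis vectors being zero. -/
def str (N : Table F) (i j k : Fin 4) : F := rel N i j k - rel N j i k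

/-- The Lie algebra named by an entry of the list: the space `F ^ 4`, with the bracket
determined by the structure constants. -/
def Alg (_ : Table F) : Type u := Fin 4 → F

instance (N : Table F) : AddCommGroup (Alg N) := inferInstanceAs (AddCommGroup (Fin 4 → F))

instance (N : Table F) : Module F (Alg N) := inferInstanceAs (Module F (Fin 4 → F))

/-- The bilinear extension of the brackets of basis vectors. -/
instance (N : Table F) : Bracket (Alg N) (Alg N) :=
  ⟨fun x y k => ∑ i : Fin 4, ∑ j : Fin 4, x i * y j * str N i j k⟩

theorem bracket_apply (N : Table F) (x y : Alg N) (k : Fin 4) :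
    ⁅x, y⁆ k = ∑ i : Fin 4, ∑ j : Fin 4, x i * y j * str N i j k := rfl

theorem add_apply (N : Table F) (x y : Alg N) (k : Fin 4) : (x + y) k = x k + y k := rfl

theorem smul_apply (N : Table F) (c : F) (x : Alg N) (k : Fin 4) : (c • x) k = c * x k := rfl

theorem zero_apply (N : Table F) (k : Fin 4) : (0 : Alg N) k = 0 := rfl

/-- The coordinates of a bracket, multiplied out. -/
def coords (N : Table F) (x y : Fin 4 → F) : Fin 4 → F :=
  match N with
  | .n1 =>
    ![(x 3 * y 0 - x 0 * y 3),
      (x 3 * y 1 - x 1 * y 3),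
      (x 3 * y 2 - x 2 * y 3),
      0]
  | .n2 α =>
    ![(x 3 * y 0 - x 0 * y 3),
      -α * (x 3 * y 2 - x 2 * y 3),
      (x 3 * y 1 - x 1 * y 3) + (α + 1) * (x 3 * y 2 - x 2 * y 3),
      0]
  | .n3 =>
    ![0,
      0,
      (x 3 * y 1 - x 1 * y 3) + (x 3 * y 2 - x 2 * y 3),
      0]
  | .n4 =>
    ![0,
      0,
      (x 3 * y 1 - x 1 * y 3),
      0]
  | .n5 α β =>
    ![α * (x 3 * y 2 - x 2 * y 3),
      (x 3 * y 0 - x 0 * y 3) + β * (x 3 * y 2 - x 2 * y 3),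
      (x 3 * y 1 - x 1 * y 3) + (x 3 * y 2 - x 2 * y 3),
      0]
  | .n6 α β =>
    ![α * (x 3 * y 2 - x 2 * y 3),
      (x 3 * y 0 - x 0 * y 3) + β * (x 3 * y 2 - x 2 * y 3),
      (x 3 * y 1 - x 1 * y 3),
      0]
  | .n7 =>
    ![0,
      (x 0 * y 1 - x 1 * y 0),
      0,
      (x 2 * y 3 - x 3 * y 2)]
  | .n8 α _ =>
    ![(x 3 * y 0 - x 0 * y 3) + (x 3 * y 1 - x 1 * y 3) + (x 2 * y 0 - x 0 * y 2),
      α * (x 3 * y 0 - x 0 * y 3) + (x 2 * y 1 - x 1 * y 2),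
      0,
      0]
  | .n9 α _ _ =>
    ![α * (x 3 * y 1 - x 1 * y 3) + (x 2 * y 0 - x 0 * y 2),
      (x 3 * y 0 - x 0 * y 3) + (x 2 * y 1 - x 1 * y 2),
      0,
      0]
  | .n10 α β _ _ _ =>
    ![(x 3 * y 0 - x 0 * y 3) + α * (x 2 * y 1 - x 1 * y 2),
      (x 2 * y 0 - x 0 * y 2) + β * (x 3 * y 1 - x 1 * y 3),
      (1 + β) * (x 3 * y 2 - x 2 * y 3),
      0]
  | .n11 =>
    ![(x 3 * y 0 - x 0 * y 3),
      (x 2 * y 0 - x 0 * y 2) + 2 * (x 3 * y 1 - x 1 * y 3),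
      (x 3 * y 2 - x 2 * y 3),
      0]
  | .n12 α =>
    ![(x 3 * y 0 - x 0 * y 3) + (x 3 * y 2 - x 2 * y 3),
      (x 2 * y 0 - x 0 * y 2) + (x 3 * y 1 - x 1 * y 3),
      α * (x 3 * y 0 - x 0 * y 3),
      0]
  | .n13 α _ =>
    ![(x 3 * y 2 - x 2 * y 3),
      (x 2 * y 0 - x 0 * y 2),
      α * (x 3 * y 0 - x 0 * y 3),
      0]

theorem bracket_eq (N : Table F) (x y : Alg N) : ⁅x, y⁆ = coords N x y := by
  funext k
  simp only [bracket_apply, Fin.sum_univ_four, str]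
  cases N
  all_goals fin_cases k
  all_goals simp [rel, coords]
  all_goals try ring

theorem jacobi (N : Table F) (x y z : Alg N) : ⁅x, ⁅y, z⁆⁆ = ⁅⁅x, y⁆, z⁆ + ⁅y, ⁅x, z⁆⁆ := by
  funext k
  rw [add_apply, bracket_eq N x ⁅y, z⁆, bracket_eq N ⁅x, y⁆ z, bracket_eq N y ⁅x, z⁆,
    bracket_eq N x y, bracket_eq N y z, bracket_eq N x z]
  cases N with
  | n10 α β h2 hα hβ =>
    have h : (2 : F) = 0 := CharTwo.two_eq_zero
    fin_cases k
    all_goals simp [coords]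
    all_goals grind
  | _ =>
    fin_cases k
    all_goals simp [coords]
    all_goals try ring

instance (N : Table F) : LieRing (Alg N) where
  add_lie x y z := by
    funext k
    simp only [add_apply, bracket_apply, add_mul, Finset.sum_add_distrib]
  lie_add x y z := by
    funext k
    simp only [add_apply, bracket_apply, mul_add, add_mul, Finset.sum_add_distrib]
  lie_self x := by
    funext k
    simp only [bracket_apply, Fin.sum_univ_four, str, zero_apply]
    ring
  leibniz_lie := jacobi N

instance (N : Table F) : LieAlgebra F (Alg N) where
  lie_smul c x y := by
    funext k
    simp only [smul_apply, bracket_apply, Finset.mul_sum]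
    refine Finset.sum_congr rfl fun i _ => Finset.sum_congr rfl fun j _ => ?_
    ring

/-- The first basis vector. -/
def e₁ {N : Table F} : Alg N := (Pi.single 0 1 : Fin 4 → F)

/-- The second basis vector. -/
def e₂ {N : Table F} : Alg N := (Pi.single 1 1 : Fin 4 → F)

/-- The third basis vector. -/
def e₃ {N : Table F} : Alg N := (Pi.single 2 1 : Fin 4 → F)

/-- The fourth basis vector. -/
def e₄ {N : Table F} : Alg N := (Pi.single 3 1 : Fin 4 → F)

/-- The connected components of the commuting graph of the Lie algebra named by `N` are the
members of the set `C`, described in terms of the basis vectors, and if `F` has a finite number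
`q` of elements then their number is `n q`. -/
def HasComponents (F : Type u) [Field F] (N : Table F)
    (C : (e₁ e₂ e₃ e₄ : Alg N) → Set (GraphIn (Alg N))) (n : ℕ → ℕ) : Prop :=
  CC F (Alg N) = C e₁ e₂ e₃ e₄ ∧ (Finite F → (CC F (Alg N)).ncard = n (Nat.card F))

/-- The subgraph of the commuting graph induced by the nonzero elements of the span of the
first three basis vectors. -/
def inducedFirstThree (N : Table F) : GraphIn (Alg N) :=
  (commutingGraph F (Alg N)).induce (sharp (span F {e₁, e₂, e₃}))

end SolvLie

open SolvLie

/-!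
The components of the commuting graph are found by exhibiting a family of connected subgraphs
that cover the noncentral elements and contain every edge at each of their vertices
(`components_eq`, `CC_eq_range`). When commuting is transitive on the noncentral elements, such a
family is given by the complete graphs on the centralizers without the centre
(`CC_eq_range_completeOn`). A vertex of each component that lies in no other member of the family
shows that the parametrization is injective, so that the components can be counted; and a family
with two members shows that the graph is not connected. The algebras fall into the following
kinds.

* `e₄` acts on the abelian ideal spanned by `e₁`, `e₂`, `e₃` by a linear map `D`, whose kernel
  `Z` is the centre. Two elements `a + s e₄` and `b + t e₄` commute if and only if
  `D (s b - t a) = 0`. Hence the ideal without `Z` is one component, and the others are the lines,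
  modulo `Z`, that are not in the ideal (`CC_of_abelian_ideal`).
* `e₃` and `e₄` span a quadratic extension `K` of the field, acting on the span of `e₁` and `e₂`
  as on a line over `K`. The centralizers are the lines over `K` (`hasComponents_of_quadratic`); the
  equations are solvable because the norm form of `K` is anisotropic.
* Elements commute if and only if they are proportional modulo the centre, and the components are
  the points of a projective plane (`hasComponents_of_proportional`).
* The elements outside the ideal spanned by `e₁`, `e₂`, `e₃` commute only with their multiples, and
  the ideal is a Heisenberg algebra with centre spanned by `e₂`. Its lines modulo `e₂` are the vanes
  of a windmill (`hasComponents_of_firstThree`, `isWindmill_firstThree`).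
* In the two-parameter family in characteristic two, an element commutes only with its multiples
  if it acts invertibly on the span of `e₁` and `e₂` (`lie_n10_eq_zero_iff_of_ne`). If `α β` is the
  square of `γ`, the elements outside this span that act singularly all have the kernel spanned by
  `γ e₁ + e₂`, which joins them to the span in one component (`components_n10_of_sq`).
* In the two remaining algebras, explicit paths connect all vertices (`connected_n7`,
  `connected_n12_zero`).
-/

namespace SolvLie

/-! ### Recognizing the connected components of a graph -/

/-- A connected subgraph that contains every edge of `G` at each of its vertices is the
component of `G` of any of its vertices. -/
theorem induce_supp_eq {L : Type u} {G H : GraphIn L} (hconn : H.Connected) (hle : H ≤ G)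
    (hclosed : ∀ x ∈ H.verts, ∀ y, G.Adj x y → H.Adj x y) {x : G.verts} (hx : x.1 ∈ H.verts) :
    G.induce (Subtype.val '' (G.coe.connectedComponentMk x).supp) = H := by
  have hverts : Subtype.val '' (G.coe.connectedComponentMk x).supp = H.verts := by
    ext y
    constructor
    · rintro ⟨z, hz, rfl⟩
      obtain ⟨w⟩ := (SimpleGraph.ConnectedComponent.exact hz).symm
      clear hz
      induction w with
      | nil => exact hx
      | cons h _ ih => exact ih (hclosed _ hx _ h).snd_mem
    · intro hy
      have hr := hconn.coe.preconnected ⟨x.1, hx⟩ ⟨y, hy⟩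
      have hr' := hr.map (SimpleGraph.Subgraph.inclusion hle)
      exact ⟨⟨y, hle.1 hy⟩, (SimpleGraph.ConnectedComponent.sound hr').symm, rfl⟩
  rw [hverts]
  ext a b
  · rfl
  · constructor
    · rintro ⟨ha, -, hab⟩
      exact hclosed a ha b hab
    · intro h
      exact ⟨h.fst_mem, h.snd_mem, hle.2 h⟩

theorem components_eq {L : Type u} {G : GraphIn L} {C : Set (GraphIn L)}
    (hconn : ∀ H ∈ C, H.Connected) (hle : ∀ H ∈ C, H ≤ G)
    (hclosed : ∀ H ∈ C, ∀ x ∈ H.verts, ∀ y, G.Adj x y → H.Adj x y)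
    (hcover : ∀ x ∈ G.verts, ∃ H ∈ C, x ∈ H.verts) : components G = C := by
  ext H
  constructor
  · rintro ⟨c, rfl⟩
    induction c using SimpleGraph.ConnectedComponent.ind with | _ x
    obtain ⟨H, hH, hx⟩ := hcover x.1 x.2
    rwa [induce_supp_eq (hconn H hH) (hle H hH) (hclosed H hH) hx]
  · intro hH
    obtain ⟨x, hx⟩ := (hconn H hH).nonempty
    exact ⟨G.coe.connectedComponentMk ⟨x, (hle H hH).1 hx⟩,
      (induce_supp_eq (hconn H hH) (hle H hH) (hclosed H hH) hx).symm⟩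

theorem components_eq_singleton {L : Type u} {G : GraphIn L} (hG : G.Connected) :
    components G = {G} :=
  components_eq (by simpa) (by simp) (by simp) (by simp)

theorem completeOn_connected {L : Type u} {S : Set L} (hS : S.Nonempty) :
    (completeOn S).Connected := by
  rw [SimpleGraph.Subgraph.connected_iff]
  refine ⟨⟨fun x y => ?_⟩, hS⟩
  by_cases h : x = y
  · rw [h]
  · exact SimpleGraph.Adj.reachable (G := (completeOn S).coe)
      ⟨x.2, y.2, fun h' => h (Subtype.ext h')⟩

theorem connected_of_reachable {L : Type u} {H : GraphIn L} {c : L} (hc : c ∈ H.verts)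
    (h : ∀ x (hx : x ∈ H.verts), H.coe.Reachable ⟨c, hc⟩ ⟨x, hx⟩) : H.Connected := by
  rw [SimpleGraph.Subgraph.connected_iff]
  exact ⟨⟨fun x y => (h x.1 x.2).symm.trans (h y.1 y.2)⟩, ⟨c, hc⟩⟩

theorem reachable_of_adj {L : Type u} {H : GraphIn L} {x y : L} (h : H.Adj x y) :
    H.coe.Reachable ⟨x, h.fst_mem⟩ ⟨y, h.snd_mem⟩ :=
  SimpleGraph.Adj.reachable (G := H.coe) h

/-! ### Commuting graphs -/

section Commuting

variable {F : Type u} [Field F] {L : Type u} [LieRing L] [LieAlgebra F L]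

theorem mem_center_iff {x : L} : x ∈ LieAlgebra.center F L ↔ ∀ y : L, ⁅x, y⁆ = 0 := by
  rw [LieAlgebra.center, LieModule.mem_maxTrivSubmodule]
  refine forall_congr' fun y => ?_
  rw [← lie_skew, neg_eq_zero]

/-- A family of connected subgraphs of the commuting graph that are closed under adjacency and
cover all vertices is the family of components. The vertices `v i` tell its members apart. -/
theorem CC_eq_range {ι : Type*} (H : ι → GraphIn L) (v : ι → L)
    (hconn : ∀ i, (H i).Connected) (hle : ∀ i, H i ≤ commutingGraph F L)
    (hclosed : ∀ i, ∀ x ∈ (H i).verts, ∀ y, (commutingGraph F L).Adj x y → (H i).Adj x y)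
    (hcover : ∀ x ∉ LieAlgebra.center F L, ∃ i, x ∈ (H i).verts)
    (hv : ∀ i, v i ∈ (H i).verts) (hinj : ∀ i j, v i ∈ (H j).verts → i = j) :
    CC F L = Set.range H ∧ (CC F L).ncard = Nat.card ι ∧
      (Nontrivial ι → ¬ (commutingGraph F L).Connected) := by
  have h : CC F L = Set.range H := by
    refine components_eq ?_ ?_ ?_ ?_
    · rintro _ ⟨i, rfl⟩
      exact hconn i
    · rintro _ ⟨i, rfl⟩
      exact hle i
    · rintro _ ⟨i, rfl⟩
      exact hclosed i
    · intro x hx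
      obtain ⟨i, hi⟩ := hcover x hx
      exact ⟨H i, ⟨i, rfl⟩, hi⟩
  have hHinj : Function.Injective H := fun i j hij => hinj i j (hij ▸ hv i)
  refine ⟨h, by rw [h, Set.ncard_range_of_injective hHinj], fun hι hG => ?_⟩
  obtain ⟨i, j, hij⟩ := hι.exists_pair_ne
  have hs : ∀ k, H k = commutingGraph F L := fun k => by
    have hk : H k ∈ CC F L := h ▸ ⟨k, rfl⟩
    rwa [CC, components_eq_singleton hG] at hk
  exact hij (hHinj ((hs i).trans (hs j).symm))

theorem completeOn_le_commutingGraph {S : Set L} (hS : ∀ x ∈ S, x ∉ LieAlgebra.center F L)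
    (hcomm : ∀ x ∈ S, ∀ y ∈ S, ⁅x, y⁆ = 0) : completeOn S ≤ commutingGraph F L :=
  ⟨hS, fun x y h => ⟨hS x h.1, hS y h.2.1, h.2.2, hcomm x h.1 y h.2.1⟩⟩

/-- If the noncentral elements are partitioned into sets `S i`, and the noncentral elements that
commute with an element of `S i` are those of `S i`, then the components are the complete graphs
on these sets. -/
theorem CC_eq_range_completeOn {ι : Type*} (S : ι → Set L) (v : ι → L)
    (hS : ∀ i, ∀ x ∈ S i, x ∉ LieAlgebra.center F L)
    (hcomm : ∀ i, ∀ x ∈ S i, ∀ y ∉ LieAlgebra.center F L, ⁅x, y⁆ = 0 ↔ y ∈ S i)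
    (hcover : ∀ x ∉ LieAlgebra.center F L, ∃ i, x ∈ S i)
    (hv : ∀ i, v i ∈ S i) (hinj : ∀ i j, v i ∈ S j → i = j) :
    CC F L = Set.range (fun i => completeOn (S i)) ∧ (CC F L).ncard = Nat.card ι ∧
      (Nontrivial ι → ¬ (commutingGraph F L).Connected) := by
  refine CC_eq_range (fun i => completeOn (S i)) v (fun i => completeOn_connected ⟨_, hv i⟩)
    (fun i => completeOn_le_commutingGraph (hS i)
      fun x hx y hy => (hcomm i x hx y (hS i y hy)).2 hy)
    (fun i x hx y h => ?_) hcover hv hinj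
  exact ⟨hx, (hcomm i x hx y h.2.1).1 h.2.2.2, h.2.2.1⟩

theorem sharpAdd_bot (W : Submodule F L) : sharpAdd W ⊥ = sharp W := by
  simp [sharpAdd]

theorem mem_sharpAdd_iff {W Z : Submodule F L} {x : L} :
    x ∈ sharpAdd W Z ↔ ∃ w ∈ W, w ≠ 0 ∧ x - w ∈ Z := by
  rw [sharpAdd, Set.mem_add]
  constructor
  · rintro ⟨w, ⟨hw, h0⟩, z, hz, rfl⟩
    exact ⟨w, hw, h0, by simpa using hz⟩
  · rintro ⟨w, hw, h0, hz⟩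
    exact ⟨w, ⟨hw, h0⟩, x - w, hz, by simp⟩

theorem mem_sharp_span_singleton_iff {a x : L} (ha : a ≠ 0) :
    x ∈ sharp (span F {a}) ↔ ∃ c : F, c ≠ 0 ∧ x = c • a := by
  constructor
  · rintro ⟨hx, h0⟩
    obtain ⟨c, rfl⟩ := Submodule.mem_span_singleton.1 hx
    exact ⟨c, fun hc => h0 (by simp [hc]), rfl⟩
  · rintro ⟨c, hc, rfl⟩
    exact ⟨Submodule.mem_span_singleton.2 ⟨c, rfl⟩, smul_ne_zero hc ha⟩

/-- The case of an abelian ideal of codimension one, the kernel of `φ`: the Lie algebra is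
spanned by the ideal and `e`, two elements commute if and only if a certain combination of them,
which lies in the ideal, lies in the centre `Z`, and `W` is a complement of `Z` in the ideal. -/
theorem CC_of_abelian_ideal (φ : L →ₗ[F] F) (e : L) (he : φ e = 1) (Z W : Submodule F L)
    (hcomm : ∀ x y : L, ⁅x, y⁆ = 0 ↔ φ y • x - φ x • y ∈ Z)
    (hWφ : ∀ w ∈ W, φ w = 0) (hZφ : ∀ z ∈ Z, φ z = 0) (hzero : ∀ w ∈ W, w ∈ Z → w = 0)
    (hsplit : ∀ x, φ x = 0 → ∃ w ∈ W, x - w ∈ Z) (hW : W ≠ ⊥) :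
    CC F L = {H | H = completeOn (sharpAdd W Z) ∨
      ∃ w ∈ W, H = completeOn (sharpAdd (span F {w + e}) Z)} ∧
    (CC F L).ncard = Nat.card (Option W) ∧ ¬ (commutingGraph F L).Connected := by
  obtain ⟨w₀, hw₀, hw₀'⟩ := (Submodule.ne_bot_iff W).1 hW
  have hcenter : ∀ x : L, x ∈ LieAlgebra.center F L ↔ x ∈ Z := by
    intro x
    rw [mem_center_iff]
    constructor
    · intro h
      by_cases hx : φ x = 0
      · simpa [hx, he] using (hcomm x e).1 (h e)
      · have h1 := (hcomm x w₀).1 (h w₀)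
        rw [hWφ w₀ hw₀, zero_smul, zero_sub, Z.neg_mem_iff, Z.smul_mem_iff hx] at h1
        exact absurd (hzero w₀ hw₀ h1) hw₀'
    · intro h y
      rw [hcomm, hZφ x h, zero_smul, sub_zero]
      exact Z.smul_mem _ h
  have hne : ∀ w ∈ W, w + e ≠ 0 := by
    intro w hw h
    have := congrArg φ h
    simp [hWφ w hw, he] at this
  -- a line modulo `Z` outside the ideal is determined by its point `w + e` with `φ (w + e) = 1`
  have hline : ∀ w ∈ W, ∀ x, x ∈ sharpAdd (span F {w + e}) Z ↔
      φ x ≠ 0 ∧ x - φ x • (w + e) ∈ Z := by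
    intro w hw x
    rw [mem_sharpAdd_iff]
    constructor
    · rintro ⟨y, hy, hy0, hz⟩
      obtain ⟨c, rfl⟩ := Submodule.mem_span_singleton.1 hy
      have h1 := hZφ _ hz
      simp only [map_sub, map_smul, map_add, hWφ w hw, he, smul_eq_mul, zero_add, mul_one] at h1
      rw [sub_eq_zero] at h1
      rw [h1]
      exact ⟨fun hc => hy0 (by simp [hc]), hz⟩
    · rintro ⟨hx, hz⟩
      exact ⟨_, Submodule.mem_span_singleton.2 ⟨_, rfl⟩, smul_ne_zero hx (hne w hw), hz⟩
  have hideal : ∀ x, x ∈ sharpAdd W Z ↔ φ x = 0 ∧ x ∉ Z := by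
    intro x
    rw [mem_sharpAdd_iff]
    constructor
    · rintro ⟨w, hw, hw0, hz⟩
      have h1 := hZφ _ hz
      rw [map_sub, hWφ w hw, sub_zero] at h1
      refine ⟨h1, fun hx => hw0 (hzero w hw ?_)⟩
      simpa using Z.sub_mem hx hz
    · rintro ⟨hx, hxZ⟩
      obtain ⟨w, hw, hz⟩ := hsplit x hx
      exact ⟨w, hw, fun h => hxZ (by simpa [h] using hz), hz⟩
  let S : Option W → Set L := fun i =>
    i.elim (sharpAdd W Z) (fun w => sharpAdd (span F {w.1 + e}) Z)
  let v : Option W → L := fun i => i.elim w₀ (fun w => w.1 + e)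
  have key := CC_eq_range_completeOn (F := F) S v ?_ ?_ ?_ ?_ ?_
  · refine ⟨?_, ?_, key.2.2 inferInstance⟩
    · rw [key.1]
      ext H
      constructor
      · rintro ⟨_ | w, rfl⟩
        · exact Or.inl rfl
        · exact Or.inr ⟨w.1, w.2, rfl⟩
      · rintro (rfl | ⟨w, hw, rfl⟩)
        · exact ⟨none, rfl⟩
        · exact ⟨some ⟨w, hw⟩, rfl⟩
    · exact key.2.1
  · rintro (_ | w) x hx
    · rw [hcenter]
      exact ((hideal x).1 hx).2
    · rw [hcenter]
      intro hz
      exact ((hline w.1 w.2 x).1 hx).1 (hZφ x hz)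
  · rintro (_ | w) x hx y hy <;> rw [hcenter] at hy
    · obtain ⟨h1, h2⟩ := (hideal x).1 hx
      change _ ↔ y ∈ sharpAdd W Z
      rw [hcomm, hideal, h1, zero_smul, sub_zero]
      constructor
      · intro h
        refine ⟨by_contra fun hφ => h2 ((Z.smul_mem_iff hφ).1 h), hy⟩
      · rintro ⟨h, -⟩
        simp [h]
    · obtain ⟨h1, h2⟩ := (hline w.1 w.2 x).1 hx
      change _ ↔ y ∈ sharpAdd (span F {w.1 + e}) Z
      rw [hcomm, hline w.1 w.2]
      have hd : φ y • x - φ x • y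
          = φ y • (x - φ x • (w.1 + e)) - φ x • (y - φ y • (w.1 + e)) := by
        rw [smul_sub, smul_sub, smul_smul, smul_smul, mul_comm (φ y)]
        abel
      rw [hd, Z.sub_mem_iff_right (Z.smul_mem _ h2), Z.smul_mem_iff h1]
      refine ⟨fun h => ⟨fun h0 => hy ?_, h⟩, fun h => h.2⟩
      simpa [h0] using h
  · intro x hx
    rw [hcenter] at hx
    by_cases hφ : φ x = 0
    · exact ⟨none, (hideal x).2 ⟨hφ, hx⟩⟩
    · obtain ⟨w, hw, hz⟩ := hsplit ((φ x)⁻¹ • x - e) (by simp [he, hφ])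
      refine ⟨some ⟨w, hw⟩, (hline w hw x).2 ⟨hφ, ?_⟩⟩
      have h2 : x - φ x • (w + e) = φ x • ((φ x)⁻¹ • x - e - w) := by
        rw [smul_sub, smul_sub, smul_smul, mul_inv_cancel₀ hφ, one_smul, smul_add]
        abel
      rw [h2]
      exact Z.smul_mem _ hz
  · rintro (_ | w)
    · exact (hideal _).2 ⟨hWφ _ hw₀, fun h => hw₀' (hzero _ hw₀ h)⟩
    · refine (hline w.1 w.2 _).2 ⟨?_, ?_⟩ <;> simp [v, hWφ w.1 w.2, he]
  · rintro (_ | w) (_ | w') h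
    · rfl
    · exact absurd (hWφ _ hw₀) ((hline w'.1 w'.2 _).1 h).1
    · have := ((hideal _).1 h).1
      simp [v, hWφ w.1 w.2, he] at this
    · have h1 := ((hline w'.1 w'.2 _).1 h).2
      simp only [v, Option.elim, map_add, hWφ w.1 w.2, he, zero_add, one_smul,
        add_sub_add_right_eq_sub] at h1
      have := hzero _ (W.sub_mem w.2 w'.2) h1
      rw [sub_eq_zero] at this
      rw [Subtype.ext this]

end Commuting

/-! ### Coordinates -/

section Coordinates

variable {F : Type u} [Field F] {N : Table F}

attribute [simp] add_apply smul_apply zero_apply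

@[simp] theorem sub_apply (x y : Alg N) (k : Fin 4) : (x - y) k = x k - y k := rfl

@[simp] theorem e₁_apply (k : Fin 4) : (e₁ : Alg N) k = if k = 0 then 1 else 0 :=
  Pi.single_apply (M := F) 0 1 k

@[simp] theorem e₂_apply (k : Fin 4) : (e₂ : Alg N) k = if k = 1 then 1 else 0 :=
  Pi.single_apply (M := F) 1 1 k

@[simp] theorem e₃_apply (k : Fin 4) : (e₃ : Alg N) k = if k = 2 then 1 else 0 :=
  Pi.single_apply (M := F) 2 1 k

@[simp] theorem e₄_apply (k : Fin 4) : (e₄ : Alg N) k = if k = 3 then 1 else 0 :=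
  Pi.single_apply (M := F) 3 1 k

theorem Alg.ext_iff {x y : Alg N} :
    x = y ↔ x 0 = y 0 ∧ x 1 = y 1 ∧ x 2 = y 2 ∧ x 3 = y 3 := by
  constructor
  · rintro rfl
    simp
  · rintro ⟨h0, h1, h2, h3⟩
    funext k
    fin_cases k <;> assumption

theorem lie_eq_zero_iff {x y : Alg N} :
    ⁅x, y⁆ = 0 ↔ coords N x y 0 = 0 ∧ coords N x y 1 = 0 ∧ coords N x y 2 = 0 ∧
      coords N x y 3 = 0 := by
  rw [bracket_eq]
  exact Alg.ext_iff

/-- The coordinate with respect to the last basis vector. -/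
def lastCoord (N : Table F) : Alg N →ₗ[F] F where
  toFun x := x 3
  map_add' _ _ := rfl
  map_smul' _ _ := rfl

@[simp] theorem lastCoord_apply (x : Alg N) : lastCoord N x = x 3 := rfl

theorem mem_span_e₁_e₂_e₃ {x : Alg N} : x ∈ span F {e₁, e₂, e₃} ↔ x 3 = 0 := by
  simp only [Submodule.mem_span_triple, Alg.ext_iff]
  refine ⟨?_, fun h => ⟨x 0, x 1, x 2, ?_⟩⟩
  · rintro ⟨a, b, c, h⟩
    simpa [eq_comm] using h.2.2.2
  · simp [h]

theorem mem_span_e₁_e₂ {x : Alg N} : x ∈ span F {e₁, e₂} ↔ x 2 = 0 ∧ x 3 = 0 := by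
  simp only [Submodule.mem_span_pair, Alg.ext_iff]
  refine ⟨?_, fun h => ⟨x 0, x 1, ?_⟩⟩
  · rintro ⟨a, b, h⟩
    simp at h
    grind
  · simp [h]

theorem mem_span_e₁_e₃ {x : Alg N} : x ∈ span F {e₁, e₃} ↔ x 1 = 0 ∧ x 3 = 0 := by
  simp only [Submodule.mem_span_pair, Alg.ext_iff]
  refine ⟨?_, fun h => ⟨x 0, x 2, ?_⟩⟩
  · rintro ⟨a, b, h⟩
    simp at h
    grind
  · simp [h]

theorem mem_span_e₂_e₃ {x : Alg N} : x ∈ span F {e₂, e₃} ↔ x 0 = 0 ∧ x 3 = 0 := by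
  simp only [Submodule.mem_span_pair, Alg.ext_iff]
  refine ⟨?_, fun h => ⟨x 1, x 2, ?_⟩⟩
  · rintro ⟨a, b, h⟩
    simp at h
    grind
  · simp [h]

theorem mem_span_e₂ {x : Alg N} : x ∈ span F {e₂} ↔ x 0 = 0 ∧ x 2 = 0 ∧ x 3 = 0 := by
  simp only [Submodule.mem_span_singleton, Alg.ext_iff]
  refine ⟨?_, fun h => ⟨x 1, ?_⟩⟩
  · rintro ⟨a, h⟩
    simp at h
    grind
  · simp [h]

theorem mem_span_e₃ {x : Alg N} : x ∈ span F {e₃} ↔ x 0 = 0 ∧ x 1 = 0 ∧ x 3 = 0 := by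
  simp only [Submodule.mem_span_singleton, Alg.ext_iff]
  refine ⟨?_, fun h => ⟨x 2, ?_⟩⟩
  · rintro ⟨a, h⟩
    simp at h
    grind
  · simp [h]

theorem mem_span_e₂_sub_e₃ {x : Alg N} :
    x ∈ span F {e₂ - e₃} ↔ x 0 = 0 ∧ x 1 + x 2 = 0 ∧ x 3 = 0 := by
  simp only [Submodule.mem_span_singleton, Alg.ext_iff]
  refine ⟨?_, fun h => ⟨x 1, ?_⟩⟩
  · rintro ⟨a, h⟩
    simp at h
    grind
  · simp
    grind

theorem mem_span_e₁_e₂_sub_e₃ {x : Alg N} :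
    x ∈ span F {e₁, e₂ - e₃} ↔ x 1 + x 2 = 0 ∧ x 3 = 0 := by
  simp only [Submodule.mem_span_pair, Alg.ext_iff]
  refine ⟨?_, fun h => ⟨x 0, x 1, ?_⟩⟩
  · rintro ⟨a, b, h⟩
    simp at h
    grind
  · simp
    grind

theorem mem_span_smul_e₁_add_e₂_sub_e₃ {β : F} {x : Alg N} :
    x ∈ span F {β • e₁ + e₂ - e₃} ↔ x 0 = β * x 1 ∧ x 1 + x 2 = 0 ∧ x 3 = 0 := by
  simp only [Submodule.mem_span_singleton, Alg.ext_iff]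
  refine ⟨?_, fun h => ⟨x 1, ?_⟩⟩
  · rintro ⟨a, h⟩
    simp at h
    grind
  · simp
    grind

theorem mem_span_smul_e₁_sub_e₃ {β : F} {x : Alg N} :
    x ∈ span F {β • e₁ - e₃} ↔ x 0 + β * x 2 = 0 ∧ x 1 = 0 ∧ x 3 = 0 := by
  simp only [Submodule.mem_span_singleton, Alg.ext_iff]
  refine ⟨?_, fun h => ⟨-x 2, ?_⟩⟩
  · rintro ⟨a, h⟩
    simp at h
    grind
  · simp
    grind

theorem e₁_ne_zero : (e₁ : Alg N) ≠ 0 := fun h => by simpa using congrFun h 0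

theorem e₂_ne_zero : (e₂ : Alg N) ≠ 0 := fun h => by simpa using congrFun h 1

theorem e₃_ne_zero : (e₃ : Alg N) ≠ 0 := fun h => by simpa using congrFun h 2

theorem e₄_ne_zero : (e₄ : Alg N) ≠ 0 := fun h => by simpa using congrFun h 3

instance (N : Table F) [Finite F] : Finite (Alg N) := inferInstanceAs (Finite (Fin 4 → F))

instance (N : Table F) : FiniteDimensional F (Alg N) :=
  inferInstanceAs (FiniteDimensional F (Fin 4 → F))

theorem natCard_span_range {k : ℕ} {v : Fin k → Alg N} (hv : LinearIndependent F v) :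
    Nat.card (span F (Set.range v)) = Nat.card F ^ k := by
  rw [Module.natCard_eq_pow_finrank (K := F), finrank_span_eq_card hv, Fintype.card_fin]

theorem natCard_span_singleton {a : Alg N} (ha : a ≠ 0) :
    Nat.card (span F {a}) = Nat.card F ^ 1 := by
  rw [Module.natCard_eq_pow_finrank (K := F), finrank_span_singleton ha]

theorem natCard_span_pair {a b : Alg N} (h : ∀ r s : F, r • a + s • b = 0 → r = 0 ∧ s = 0) :
    Nat.card (span F {a, b}) = Nat.card F ^ 2 := by
  have := natCard_span_range (v := ![a, b]) (LinearIndependent.pair_iff.2 h)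
  rwa [Matrix.range_cons_cons_empty] at this

theorem natCard_span_triple {a b c : Alg N}
    (h : ∀ r s t : F, r • a + s • b + t • c = 0 → r = 0 ∧ s = 0 ∧ t = 0) :
    Nat.card (span F {a, b, c}) = Nat.card F ^ 3 := by
  have hv : LinearIndependent F ![a, b, c] := by
    rw [Fintype.linearIndependent_iff]
    intro g hg
    rw [Fin.sum_univ_three] at hg
    obtain ⟨h0, h1, h2⟩ := h _ _ _ hg
    intro i
    fin_cases i <;> assumption
  have := natCard_span_range hv
  rwa [Matrix.range_cons, Matrix.range_cons_cons_empty, Set.singleton_union] at this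

theorem natCard_span_e₁_e₂ : Nat.card (span F {(e₁ : Alg N), e₂}) = Nat.card F ^ 2 :=
  natCard_span_pair fun r s h => by simpa using And.intro (congrFun h 0) (congrFun h 1)

theorem natCard_span_e₁_e₃ : Nat.card (span F {(e₁ : Alg N), e₃}) = Nat.card F ^ 2 :=
  natCard_span_pair fun r s h => by simpa using And.intro (congrFun h 0) (congrFun h 2)

theorem natCard_span_e₂_e₃ : Nat.card (span F {(e₂ : Alg N), e₃}) = Nat.card F ^ 2 :=
  natCard_span_pair fun r s h => by simpa using And.intro (congrFun h 1) (congrFun h 2)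

theorem natCard_span_e₁_e₂_e₃ : Nat.card (span F {(e₁ : Alg N), e₂, e₃}) = Nat.card F ^ 3 :=
  natCard_span_triple fun r s t h => by
    simpa using And.intro (congrFun h 0) (And.intro (congrFun h 1) (congrFun h 2))

end Coordinates

/-! ### Algebras with an abelian ideal of dimension three -/

section AbelianIdeal

variable {F : Type u} [Field F]

/-- The components of the commuting graph are as in `HasComponents`, and the graph is not
connected. -/
def HasComponentsDisconnected (F : Type u) [Field F] (N : Table F)
    (C : (e₁ e₂ e₃ e₄ : Alg N) → Set (GraphIn (Alg N))) (n : ℕ → ℕ) : Prop :=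
  HasComponents F N C n ∧ ¬ (commutingGraph F (Alg N)).Connected

/-- The components when `e₄` acts on the abelian ideal spanned by the other basis vectors with
kernel `Z`, and `W` is a complement of `Z` in that ideal. -/
theorem hasComponents_of_complement {N : Table F} {k : ℕ} (W Z : Submodule F (Alg N))
    (hcomm : ∀ x y : Alg N, ⁅x, y⁆ = 0 ↔ y 3 • x - x 3 • y ∈ Z)
    (hW : ∀ w ∈ W, w 3 = 0) (hZ : ∀ z ∈ Z, z 3 = 0) (hzero : ∀ w ∈ W, w ∈ Z → w = 0)
    (hsplit : ∀ x : Alg N, x 3 = 0 → ∃ w ∈ W, x - w ∈ Z) {w₀ : Alg N} (hw₀ : w₀ ∈ W)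
    (hw₀' : w₀ ≠ 0) (hcard : Nat.card W = Nat.card F ^ k) :
    HasComponentsDisconnected F N (fun _ _ _ e₄ => {H | H = completeOn (sharpAdd W Z) ∨
      ∃ w ∈ W, H = completeOn (sharpAdd (span F {w + e₄}) Z)}) (fun q => q ^ k + 1) := by
  obtain ⟨h1, h2, h3⟩ := CC_of_abelian_ideal (lastCoord N) e₄ (by simp) Z W hcomm hW hZ hzero
    hsplit ((Submodule.ne_bot_iff W).2 ⟨w₀, hw₀, hw₀'⟩)
  exact ⟨⟨h1, fun hF => by rw [h2, Finite.card_option, hcard]⟩, h3⟩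

/-- The case in which `e₄` acts invertibly on the abelian ideal, so that the centre is zero. -/
theorem hasComponents_of_proportional_firstThree {N : Table F}
    (hcomm : ∀ x y : Alg N, ⁅x, y⁆ = 0 ↔
      x 3 * y 0 = x 0 * y 3 ∧ x 3 * y 1 = x 1 * y 3 ∧ x 3 * y 2 = x 2 * y 3) :
    HasComponentsDisconnected F N
      (fun e₁ e₂ e₃ e₄ => {H | H = completeOn (sharp (span F {e₁, e₂, e₃})) ∨
        (∃ μ₁ μ₂ μ₃ : F,
          H = completeOn (sharp (span F {μ₁ • e₁ + μ₂ • e₂ + μ₃ • e₃ + e₄})))})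
      (fun q => q ^ 3 + 1) := by
  have h := hasComponents_of_complement (N := N) (span F {e₁, e₂, e₃}) ⊥
    ?_ ?_ ?_ ?_ (fun x h => ⟨x 0 • e₁ + x 1 • e₂ + x 2 • e₃, ?_⟩)
    (Submodule.subset_span (Set.mem_insert e₁ _)) e₁_ne_zero natCard_span_e₁_e₂_e₃
  · simpa [HasComponentsDisconnected, HasComponents, sharpAdd_bot,
      Submodule.mem_span_triple] using h
  all_goals try simp only [hcomm]
  all_goals
    simp [mem_span_e₁_e₂_e₃, Alg.ext_iff]
    try grind

theorem components_n1 : HasComponentsDisconnected F .n1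
    (fun e₁ e₂ e₃ e₄ => {H | H = completeOn (sharp (span F {e₁, e₂, e₃})) ∨
      (∃ μ₁ μ₂ μ₃ : F, H = completeOn (sharp (span F {μ₁ • e₁ + μ₂ • e₂ + μ₃ • e₃ + e₄})))})
    (fun q => q ^ 3 + 1) :=
  hasComponents_of_proportional_firstThree fun x y => by
    rw [lie_eq_zero_iff]
    simp [coords]
    grind

theorem components_n2_zero : HasComponentsDisconnected F (.n2 0)
    (fun e₁ e₂ e₃ e₄ => {H | H = completeOn (sharpAdd (span F {e₁, e₃}) (span F {e₂ - e₃})) ∨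
      (∃ μ₁ μ₃ : F,
        H = completeOn (sharpAdd (span F {μ₁ • e₁ + μ₃ • e₃ + e₄}) (span F {e₂ - e₃})))})
    (fun q => q ^ 2 + 1) := by
  have h := hasComponents_of_complement (N := (.n2 0 : Table F)) (span F {e₁, e₃})
    (span F {e₂ - e₃})
    ?_ ?_ ?_ ?_ (fun x h => ⟨x 0 • e₁ + (x 1 + x 2) • e₃, ?_⟩)
    (Submodule.subset_span (Set.mem_insert e₁ _)) e₁_ne_zero natCard_span_e₁_e₃
  · simpa [HasComponentsDisconnected, HasComponents, Submodule.mem_span_singleton,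
      Submodule.mem_span_pair] using h
  all_goals try simp only [lie_eq_zero_iff]
  all_goals
    simp [coords, mem_span_e₁_e₃, mem_span_e₂_sub_e₃, Alg.ext_iff]
    try grind

theorem components_n2 {α : F} (hα : α ≠ 0) : HasComponentsDisconnected F (.n2 α)
    (fun e₁ e₂ e₃ e₄ => {H | H = completeOn (sharp (span F {e₁, e₂, e₃})) ∨
      (∃ μ₁ μ₂ μ₃ : F, H = completeOn (sharp (span F {μ₁ • e₁ + μ₂ • e₂ + μ₃ • e₃ + e₄})))})
    (fun q => q ^ 3 + 1) :=
  hasComponents_of_proportional_firstThree fun x y => by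
    rw [lie_eq_zero_iff]
    simp [coords]
    grind

theorem components_n3 : HasComponentsDisconnected F .n3
    (fun e₁ e₂ e₃ e₄ => {H | H = completeOn (sharpAdd (span F {e₃}) (span F {e₁, e₂ - e₃})) ∨
      (∃ μ₃ : F, H = completeOn (sharpAdd (span F {μ₃ • e₃ + e₄}) (span F {e₁, e₂ - e₃})))})
    (fun q => q + 1) := by
  have h := hasComponents_of_complement (N := (.n3 : Table F)) (span F {e₃}) (span F {e₁, e₂ - e₃})
    ?_ ?_ ?_ ?_ (fun x h => ⟨(x 1 + x 2) • e₃, ?_⟩) (Submodule.mem_span_singleton_self _)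
    e₃_ne_zero (natCard_span_singleton e₃_ne_zero)
  · simpa [HasComponentsDisconnected, HasComponents, Submodule.mem_span_singleton,
      Submodule.mem_span_pair] using h
  all_goals try simp only [lie_eq_zero_iff]
  all_goals
    simp [coords, mem_span_e₃, mem_span_e₁_e₂_sub_e₃, Alg.ext_iff]
    try grind

theorem components_n4 : HasComponentsDisconnected F .n4
    (fun e₁ e₂ e₃ e₄ => {H | H = completeOn (sharpAdd (span F {e₂}) (span F {e₁, e₃})) ∨
      (∃ μ₂ : F, H = completeOn (sharpAdd (span F {μ₂ • e₂ + e₄}) (span F {e₁, e₃})))})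
    (fun q => q + 1) := by
  have h := hasComponents_of_complement (N := (.n4 : Table F)) (span F {e₂}) (span F {e₁, e₃})
    ?_ ?_ ?_ ?_ (fun x h => ⟨x 1 • e₂, ?_⟩) (Submodule.mem_span_singleton_self _)
    e₂_ne_zero (natCard_span_singleton e₂_ne_zero)
  · simpa [HasComponentsDisconnected, HasComponents, Submodule.mem_span_singleton,
      Submodule.mem_span_pair] using h
  all_goals try simp only [lie_eq_zero_iff]
  all_goals
    simp [coords, mem_span_e₂, mem_span_e₁_e₃, Alg.ext_iff]
    try grind

theorem components_n5_zero_zero : HasComponentsDisconnected F (.n5 0 0)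
    (fun e₁ e₂ e₃ e₄ => {H | H = completeOn (sharpAdd (span F {e₁, e₂}) (span F {e₂ - e₃})) ∨
      (∃ μ₁ μ₂ : F,
        H = completeOn (sharpAdd (span F {μ₁ • e₁ + μ₂ • e₂ + e₄}) (span F {e₂ - e₃})))})
    (fun q => q ^ 2 + 1) := by
  have h := hasComponents_of_complement (N := (.n5 0 0 : Table F)) (span F {e₁, e₂})
    (span F {e₂ - e₃})
    ?_ ?_ ?_ ?_ (fun x h => ⟨x 0 • e₁ + (x 1 + x 2) • e₂, ?_⟩)
    (Submodule.subset_span (Set.mem_insert e₁ _)) e₁_ne_zero natCard_span_e₁_e₂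
  · simpa [HasComponentsDisconnected, HasComponents, Submodule.mem_span_singleton,
      Submodule.mem_span_pair] using h
  all_goals try simp only [lie_eq_zero_iff]
  all_goals
    simp [coords, mem_span_e₁_e₂, mem_span_e₂_sub_e₃, Alg.ext_iff]
    try grind

theorem components_n5_zero {β : F} (hβ : β ≠ 0) : HasComponentsDisconnected F (.n5 0 β)
    (fun e₁ e₂ e₃ e₄ => {H |
      H = completeOn (sharpAdd (span F {e₂, e₃}) (span F {β • e₁ + e₂ - e₃})) ∨
      (∃ μ₂ μ₃ : F,
        H = completeOn (sharpAdd (span F {μ₂ • e₂ + μ₃ • e₃ + e₄}) (span F {β • e₁ + e₂ - e₃})))})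
    (fun q => q ^ 2 + 1) := by
  have h := hasComponents_of_complement (N := (.n5 0 β : Table F)) (span F {e₂, e₃})
    (span F {β • e₁ + e₂ - e₃})
    ?_ ?_ ?_ ?_ (fun x h => ⟨(x 1 - x 0 / β) • e₂ + (x 2 + x 0 / β) • e₃, ?_⟩)
    (Submodule.subset_span (Set.mem_insert e₂ _)) e₂_ne_zero natCard_span_e₂_e₃
  · simpa [HasComponentsDisconnected, HasComponents, Submodule.mem_span_singleton,
      Submodule.mem_span_pair] using h
  all_goals try simp only [lie_eq_zero_iff]
  all_goals
    simp [coords, mem_span_e₂_e₃, mem_span_smul_e₁_add_e₂_sub_e₃, Alg.ext_iff]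
    try grind

theorem components_n5 {α β : F} (hα : α ≠ 0) : HasComponentsDisconnected F (.n5 α β)
    (fun e₁ e₂ e₃ e₄ => {H | H = completeOn (sharp (span F {e₁, e₂, e₃})) ∨
      (∃ μ₁ μ₂ μ₃ : F, H = completeOn (sharp (span F {μ₁ • e₁ + μ₂ • e₂ + μ₃ • e₃ + e₄})))})
    (fun q => q ^ 3 + 1) :=
  hasComponents_of_proportional_firstThree fun x y => by
    rw [lie_eq_zero_iff]
    simp [coords]
    grind

theorem components_n6_zero_zero : HasComponentsDisconnected F (.n6 0 0)
    (fun e₁ e₂ e₃ e₄ => {H | H = completeOn (sharpAdd (span F {e₁, e₂}) (span F {e₃})) ∨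
      (∃ μ₁ μ₂ : F, H = completeOn (sharpAdd (span F {μ₁ • e₁ + μ₂ • e₂ + e₄}) (span F {e₃})))})
    (fun q => q ^ 2 + 1) := by
  have h := hasComponents_of_complement (N := (.n6 0 0 : Table F)) (span F {e₁, e₂}) (span F {e₃})
    ?_ ?_ ?_ ?_ (fun x h => ⟨x 0 • e₁ + x 1 • e₂, ?_⟩)
    (Submodule.subset_span (Set.mem_insert e₁ _)) e₁_ne_zero natCard_span_e₁_e₂
  · simpa [HasComponentsDisconnected, HasComponents, Submodule.mem_span_singleton,
      Submodule.mem_span_pair] using h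
  all_goals try simp only [lie_eq_zero_iff]
  all_goals
    simp [coords, mem_span_e₁_e₂, mem_span_e₃, Alg.ext_iff]
    try grind

theorem components_n6_zero {β : F} (hβ : β ≠ 0) : HasComponentsDisconnected F (.n6 0 β)
    (fun e₁ e₂ e₃ e₄ => {H |
      H = completeOn (sharpAdd (span F {e₂, e₃}) (span F {β • e₁ - e₃})) ∨
      (∃ μ₂ μ₃ : F,
        H = completeOn (sharpAdd (span F {μ₂ • e₂ + μ₃ • e₃ + e₄}) (span F {β • e₁ - e₃})))})
    (fun q => q ^ 2 + 1) := by
  have h := hasComponents_of_complement (N := (.n6 0 β : Table F)) (span F {e₂, e₃})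
    (span F {β • e₁ - e₃})
    ?_ ?_ ?_ ?_ (fun x h => ⟨x 1 • e₂ + (x 2 + x 0 / β) • e₃, ?_⟩)
    (Submodule.subset_span (Set.mem_insert e₂ _)) e₂_ne_zero natCard_span_e₂_e₃
  · simpa [HasComponentsDisconnected, HasComponents, Submodule.mem_span_singleton,
      Submodule.mem_span_pair] using h
  all_goals try simp only [lie_eq_zero_iff]
  all_goals
    simp [coords, mem_span_e₂_e₃, mem_span_smul_e₁_sub_e₃, Alg.ext_iff]
    try grind

theorem components_n6 {α β : F} (hα : α ≠ 0) : HasComponentsDisconnected F (.n6 α β)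
    (fun e₁ e₂ e₃ e₄ => {H | H = completeOn (sharp (span F {e₁, e₂, e₃})) ∨
      (∃ μ₁ μ₂ μ₃ : F, H = completeOn (sharp (span F {μ₁ • e₁ + μ₂ • e₂ + μ₃ • e₃ + e₄})))})
    (fun q => q ^ 3 + 1) :=
  hasComponents_of_proportional_firstThree fun x y => by
    rw [lie_eq_zero_iff]
    simp [coords]
    grind

end AbelianIdeal

/-! ### Affine Lie algebras of quadratic field extensions -/

section QuadraticExtension

variable {F : Type u} [Field F]

theorem mem_span_e₃_e₄ {N : Table F} {x : Alg N} :
    x ∈ span F {e₃, e₄} ↔ x 0 = 0 ∧ x 1 = 0 := by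
  simp only [Submodule.mem_span_pair, Alg.ext_iff]
  refine ⟨?_, fun h => ⟨x 2, x 3, ?_⟩⟩
  · rintro ⟨a, b, h⟩
    simp at h
    grind
  · simp [h]

theorem mem_span_e₁_add_e₂_add {N : Table F} {a b c d : F} {x : Alg N} :
    x ∈ span F {e₁ + a • e₃ + b • e₄, e₂ + c • e₃ + d • e₄} ↔
      x 2 = x 0 * a + x 1 * c ∧ x 3 = x 0 * b + x 1 * d := by
  simp only [Submodule.mem_span_pair, Alg.ext_iff]
  refine ⟨?_, fun h => ⟨x 0, x 1, ?_⟩⟩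
  · rintro ⟨r, s, h⟩
    simp at h
    grind
  · simp [h]

/-- The components when the centralizers of the nonzero elements are the span of `e₃` and `e₄`
(`hcomm₁`) and, for all `a` and `b`, the graph of the linear map from the span of `e₁` and `e₂`
to the span of `e₃` and `e₄` that sends `e₁` to `a e₃ + b e₄` and `e₂` to
`c a b e₃ + d a b e₄` (`hcomm₂`). Since `c` and `d` vanish at `0`, the span of `e₁` and `e₂` is
one of these graphs. -/
theorem hasComponents_of_quadratic {N : Table F} (c d : F → F → F)
    (hc0 : c 0 0 = 0) (hd0 : d 0 0 = 0)
    (hcenter : ∀ x : Alg N, x ∈ LieAlgebra.center F (Alg N) ↔ x = 0)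
    (hcomm₁ : ∀ x y : Alg N, x ≠ 0 → x 0 = 0 → x 1 = 0 → (⁅x, y⁆ = 0 ↔ y 0 = 0 ∧ y 1 = 0))
    (hcomm₂ : ∀ (a b : F) (x y : Alg N), x ≠ 0 → x 2 = x 0 * a + x 1 * c a b →
      x 3 = x 0 * b + x 1 * d a b →
      (⁅x, y⁆ = 0 ↔ y 2 = y 0 * a + y 1 * c a b ∧ y 3 = y 0 * b + y 1 * d a b))
    (hcover : ∀ x : Alg N, ¬ (x 0 = 0 ∧ x 1 = 0) → ∃ a b : F,
      x 2 = x 0 * a + x 1 * c a b ∧ x 3 = x 0 * b + x 1 * d a b) :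
    HasComponentsDisconnected F N
      (fun e₁ e₂ e₃ e₄ => {H | H = completeOn (sharp (span F {e₁, e₂})) ∨
        H = completeOn (sharp (span F {e₃, e₄})) ∨
        (∃ a b : F, H = completeOn (sharp (span F {e₁ + a • e₃ + b • e₄,
            e₂ + c a b • e₃ + d a b • e₄})))})
      (fun q => q ^ 2 + 1) := by
  let S : Option (F × F) → Set (Alg N) := fun i => i.elim (sharp (span F {e₃, e₄}))
    (fun p => sharp (span F {e₁ + p.1 • e₃ + p.2 • e₄, e₂ + c p.1 p.2 • e₃ + d p.1 p.2 • e₄}))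
  let v : Option (F × F) → Alg N := fun i => i.elim e₄ (fun p => e₁ + p.1 • e₃ + p.2 • e₄)
  have key := CC_eq_range_completeOn (F := F) S v ?_ ?_ ?_ ?_ ?_
  · refine ⟨⟨?_, fun hF => ?_⟩, key.2.2 inferInstance⟩
    · rw [key.1]
      ext H
      constructor
      · rintro ⟨_ | ⟨a, b⟩, rfl⟩
        · exact Or.inr (Or.inl rfl)
        · exact Or.inr (Or.inr ⟨a, b, rfl⟩)
      · rintro (rfl | rfl | ⟨a, b, rfl⟩)
        · refine ⟨some (0, 0), ?_⟩
          simp [S, hc0, hd0]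
        · exact ⟨none, rfl⟩
        · exact ⟨some (a, b), rfl⟩
    · rw [key.2.1, Finite.card_option, Nat.card_prod]
      ring
  · rintro (_ | ⟨a, b⟩) x hx <;> rw [hcenter] <;> exact hx.2
  · rintro (_ | ⟨a, b⟩) x hx y hy <;> rw [hcenter] at hy
    · have h := mem_span_e₃_e₄.1 hx.1
      rw [hcomm₁ x y hx.2 h.1 h.2, ← mem_span_e₃_e₄]
      exact ⟨fun h => ⟨h, hy⟩, fun h => h.1⟩
    · have h := mem_span_e₁_add_e₂_add.1 hx.1
      rw [hcomm₂ a b x y hx.2 h.1 h.2, ← mem_span_e₁_add_e₂_add]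
      exact ⟨fun h => ⟨h, hy⟩, fun h => h.1⟩
  · intro x hx
    rw [hcenter] at hx
    by_cases h : x 0 = 0 ∧ x 1 = 0
    · exact ⟨none, mem_span_e₃_e₄.2 h, hx⟩
    · obtain ⟨a, b, hab⟩ := hcover x h
      exact ⟨some (a, b), mem_span_e₁_add_e₂_add.2 hab, hx⟩
  · rintro (_ | ⟨a, b⟩)
    · exact ⟨(mem_span_e₃_e₄ (x := e₄)).2 (by simp), e₄_ne_zero⟩
    · exact ⟨mem_span_e₁_add_e₂_add.2 (by simp [v]), fun h => by simpa [v] using congrFun h 0⟩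
  · rintro (_ | ⟨a, b⟩) (_ | ⟨a', b'⟩) ⟨h, -⟩
    · rfl
    · have h' := (mem_span_e₁_add_e₂_add (x := e₄)).1 h
      simp at h'
    · have h' := (mem_span_e₃_e₄ (x := e₁ + a • e₃ + b • e₄)).1 h
      simp at h'
    · have h' := (mem_span_e₁_add_e₂_add (x := e₁ + a • e₃ + b • e₄)).1 h
      simp at h'
      rw [h'.1, h'.2]

/-- The norm form of the extension generated by a root of `T² - T - α` is anisotropic. -/
theorem eq_zero_of_sq_add_mul_sub {α : F} (hα : ∀ T : F, T ^ 2 - T - α ≠ 0) {a b : F}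
    (h : a ^ 2 + a * b - α * b ^ 2 = 0) : a = 0 ∧ b = 0 := by
  by_cases hb : b = 0
  · simp_all
  · refine absurd ?_ (hα (-a / b))
    field_simp
    linear_combination h

/-- The norm form of the extension generated by a square root of `α` is anisotropic. -/
theorem eq_zero_of_sq_sub {α : F} (hα : ∀ γ : F, α ≠ γ ^ 2) {a b : F}
    (h : a ^ 2 - α * b ^ 2 = 0) : a = 0 ∧ b = 0 := by
  by_cases hb : b = 0
  · simp_all
  · refine absurd ?_ (hα (a / b))
    field_simp
    linear_combination -h

theorem components_n8 (α : F) (hα : ∀ T : F, T ^ 2 - T - α ≠ 0) :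
    HasComponentsDisconnected F (.n8 α hα)
      (fun e₁ e₂ e₃ e₄ => {H | H = completeOn (sharp (span F {e₁, e₂})) ∨
        H = completeOn (sharp (span F {e₃, e₄})) ∨
        (∃ μ₃ μ₄ : F, H = completeOn (sharp (span F {e₁ + μ₃ • e₃ + μ₄ • e₄,
            e₂ + (μ₄ - μ₃ / α) • e₃ + (μ₃ / α) • e₄})))})
      (fun q => q ^ 2 + 1) := by
  have hα0 : α ≠ 0 := by simpa using hα 0
  refine hasComponents_of_quadratic (fun a b => b - a / α) (fun a _ => a / α) (by simp) (by simp)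
    ?_ ?_ ?_ ?_
  · intro x
    rw [mem_center_iff]
    refine ⟨fun h => ?_, fun h => by simp [h]⟩
    have h1 := lie_eq_zero_iff.1 (h e₁)
    have h2 := lie_eq_zero_iff.1 (h e₂)
    have h3 := lie_eq_zero_iff.1 (h e₃)
    simp [coords] at h1 h2 h3
    rw [Alg.ext_iff]
    simp
    grind
  · intro x y hx h0 h1
    rw [lie_eq_zero_iff]
    simp [coords, h0, h1]
    refine ⟨fun ⟨h2, h3⟩ => ?_, fun h => by simp [h]⟩
    have hn : x 2 ^ 2 + x 2 * x 3 - α * x 3 ^ 2 ≠ 0 := fun h => hx (by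
      have := eq_zero_of_sq_add_mul_sub hα h
      simp [Alg.ext_iff, h0, h1, this])
    constructor
    · refine (mul_eq_zero.1 ?_).resolve_left hn
      linear_combination x 2 * h2 - x 3 * h3
    · refine (mul_eq_zero.1 ?_).resolve_left hn
      linear_combination (x 3 + x 2) * h3 - α * x 3 * h2
  · intro a b x y hx
    obtain ⟨t, rfl⟩ : ∃ t, a = α * t := ⟨a / α, by field_simp⟩
    rw [lie_eq_zero_iff, mul_div_cancel_left₀ _ hα0]
    intro h2 h3
    have hn : x 1 ^ 2 + x 1 * x 0 - α * x 0 ^ 2 ≠ 0 := fun h => hx (by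
      have := eq_zero_of_sq_add_mul_sub hα h
      simp [Alg.ext_iff, h2, h3, this])
    simp [coords]
    refine ⟨fun ⟨k0, k1⟩ => ⟨?_, ?_⟩, fun ⟨k2, k3⟩ => ⟨?_, ?_⟩⟩
    · refine sub_eq_zero.1 ((mul_eq_zero.1 ?_).resolve_left hn)
      rw [h2, h3] at k0 k1
      linear_combination α * x 0 * k0 - (x 0 + x 1) * k1
    · refine sub_eq_zero.1 ((mul_eq_zero.1 ?_).resolve_left hn)
      rw [h2, h3] at k0 k1
      linear_combination x 0 * k1 - x 1 * k0
    · rw [h2, h3, k2, k3]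
      ring
    · rw [h2, h3, k2, k3]
      ring
  · intro x hx
    have hn : x 1 ^ 2 + x 1 * x 0 - α * x 0 ^ 2 ≠ 0 := fun h => hx
      (eq_zero_of_sq_add_mul_sub hα h).symm
    obtain ⟨n, hn'⟩ : ∃ n, n = x 1 ^ 2 + x 1 * x 0 - α * x 0 ^ 2 := ⟨_, rfl⟩
    rw [← hn'] at hn
    -- the two equations in `μ₃` and `μ₄` are solved by Cramer's rule
    refine ⟨-α * (x 2 * x 0 - x 1 * x 3) / n, -((α * x 0 - x 1) * x 3 - x 1 * x 2) / n, ?_, ?_⟩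
    · field_simp
      rw [hn']
      ring
    · field_simp
      rw [hn']
      ring

theorem components_n9 (α : F) (h2 : CharP F 2) (hα : ∀ γ : F, α ≠ γ ^ 2) :
    HasComponentsDisconnected F (.n9 α h2 hα)
      (fun e₁ e₂ e₃ e₄ => {H | H = completeOn (sharp (span F {e₁, e₂})) ∨
        H = completeOn (sharp (span F {e₃, e₄})) ∨
        (∃ μ₃ μ₄ : F, H = completeOn (sharp (span F {e₁ + μ₃ • e₃ + μ₄ • e₄,
            e₂ + (α * μ₄) • e₃ + μ₃ • e₄})))})
      (fun q => q ^ 2 + 1) := by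
  refine hasComponents_of_quadratic (fun _ b => α * b) (fun a _ => a) (by simp) (by simp)
    ?_ ?_ ?_ ?_
  · intro x
    rw [mem_center_iff]
    refine ⟨fun h => ?_, fun h => by simp [h]⟩
    have h1 := lie_eq_zero_iff.1 (h e₁)
    have h3 := lie_eq_zero_iff.1 (h e₃)
    simp [coords] at h1 h3
    rw [Alg.ext_iff]
    simp [h1, h3]
  · intro x y hx h0 h1
    rw [lie_eq_zero_iff]
    simp [coords, h0, h1]
    refine ⟨fun ⟨k2, k3⟩ => ?_, fun h => by simp [h]⟩
    have hn : x 2 ^ 2 - α * x 3 ^ 2 ≠ 0 := fun h => hx (by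
      have := eq_zero_of_sq_sub hα h
      simp [Alg.ext_iff, h0, h1, this])
    constructor
    · refine (mul_eq_zero.1 ?_).resolve_left hn
      linear_combination x 2 * k2 - α * x 3 * k3
    · refine (mul_eq_zero.1 ?_).resolve_left hn
      linear_combination x 2 * k3 - x 3 * k2
  · intro a b x y hx k2 k3
    rw [lie_eq_zero_iff]
    have hn : x 0 ^ 2 - α * x 1 ^ 2 ≠ 0 := fun h => hx (by
      have := eq_zero_of_sq_sub hα h
      simp [Alg.ext_iff, k2, k3, this])
    simp [coords, k2, k3]
    refine ⟨fun ⟨m0, m1⟩ => ⟨?_, ?_⟩, fun ⟨m2, m3⟩ => ⟨?_, ?_⟩⟩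
    · refine sub_eq_zero.1 ((mul_eq_zero.1 ?_).resolve_left hn)
      linear_combination α * x 1 * m1 - x 0 * m0
    · refine sub_eq_zero.1 ((mul_eq_zero.1 ?_).resolve_left hn)
      linear_combination x 1 * m0 - x 0 * m1
    · rw [m2, m3]
      ring
    · rw [m2, m3]
      ring
  · intro x hx
    have hn : x 0 ^ 2 - α * x 1 ^ 2 ≠ 0 := fun h => hx (eq_zero_of_sq_sub hα h)
    obtain ⟨n, hn'⟩ : ∃ n, n = x 0 ^ 2 - α * x 1 ^ 2 := ⟨_, rfl⟩
    rw [← hn'] at hn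
    -- the two equations in `μ₃` and `μ₄` are solved by Cramer's rule
    refine ⟨(x 0 * x 2 - α * x 1 * x 3) / n, (x 0 * x 3 - x 1 * x 2) / n, ?_, ?_⟩
    · field_simp
      rw [hn']
      ring
    · field_simp
      rw [hn']
      ring

end QuadraticExtension

/-! ### Algebras in which commuting means being proportional modulo the centre -/

section Projective

variable {F : Type u} [Field F]

theorem mem_sharpAdd_span_singleton_iff {N : Table F} {a x : Alg N} {Z : Submodule F (Alg N)}
    (ha : a ≠ 0) : x ∈ sharpAdd (span F {a}) Z ↔ ∃ c : F, c ≠ 0 ∧ x - c • a ∈ Z := by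
  rw [mem_sharpAdd_iff]
  constructor
  · rintro ⟨w, hw, h0, hz⟩
    obtain ⟨c, rfl⟩ := Submodule.mem_span_singleton.1 hw
    exact ⟨c, fun hc => h0 (by simp [hc]), hz⟩
  · rintro ⟨c, hc, hz⟩
    exact ⟨c • a, Submodule.mem_span_singleton.2 ⟨c, rfl⟩, smul_ne_zero hc ha, hz⟩

theorem mem_sharpAdd_e₄_e₂ {N : Table F} {x : Alg N} :
    x ∈ sharpAdd (span F {e₄}) (span F {e₂}) ↔ x 3 ≠ 0 ∧ x 0 = 0 ∧ x 2 = 0 := by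
  rw [mem_sharpAdd_span_singleton_iff e₄_ne_zero]
  simp only [mem_span_e₂]
  simp
  exact ⟨fun ⟨c, hc⟩ => by grind, fun h => ⟨x 3, by grind⟩⟩

theorem mem_sharpAdd_e₃_add_e₂ {N : Table F} {b : F} {x : Alg N} :
    x ∈ sharpAdd (span F {e₃ + b • e₄}) (span F {e₂}) ↔
      x 2 ≠ 0 ∧ x 0 = 0 ∧ x 3 = x 2 * b := by
  rw [mem_sharpAdd_span_singleton_iff fun h => by simpa using congrFun h 2]
  simp only [mem_span_e₂]
  simp
  exact ⟨fun ⟨c, hc⟩ => by grind, fun h => ⟨x 2, by grind⟩⟩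

theorem mem_sharpAdd_e₁_add_e₂ {N : Table F} {a b : F} {x : Alg N} :
    x ∈ sharpAdd (span F {e₁ + a • e₃ + b • e₄}) (span F {e₂}) ↔
      x 0 ≠ 0 ∧ x 2 = x 0 * a ∧ x 3 = x 0 * b := by
  rw [mem_sharpAdd_span_singleton_iff fun h => by simpa using congrFun h 0]
  simp only [mem_span_e₂]
  simp
  exact ⟨fun ⟨c, hc⟩ => by grind, fun h => ⟨x 0, by grind⟩⟩

/-- The components when two elements commute if and only if they are proportional modulo the
centre, which is spanned by `e₂`: they are the points of the projective plane on the quotient. -/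
theorem hasComponents_of_proportional {N : Table F}
    (hcomm : ∀ x y : Alg N, ⁅x, y⁆ = 0 ↔
      x 3 * y 0 = x 0 * y 3 ∧ x 2 * y 0 = x 0 * y 2 ∧ x 3 * y 2 = x 2 * y 3) :
    HasComponentsDisconnected F N
      (fun e₁ e₂ e₃ e₄ => {H | H = completeOn (sharpAdd (span F {e₄}) (span F {e₂})) ∨
        (∃ μ₄ : F, H = completeOn (sharpAdd (span F {e₃ + μ₄ • e₄}) (span F {e₂}))) ∨
        (∃ μ₃ μ₄ : F, H = completeOn (sharpAdd (span F {e₁ + μ₃ • e₃ + μ₄ • e₄})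
          (span F {e₂})))})
      (fun q => q ^ 2 + q + 1) := by
  have hcenter : ∀ x : Alg N, x ∈ LieAlgebra.center F (Alg N) ↔ x 0 = 0 ∧ x 2 = 0 ∧ x 3 = 0 := by
    intro x
    rw [mem_center_iff]
    constructor
    · intro h
      have h1 := (hcomm _ _).1 (h e₁)
      have h4 := (hcomm _ _).1 (h e₄)
      simp at h1 h4
      exact ⟨h4.1.symm, h1.2, h1.1⟩
    · rintro ⟨h0, h2, h3⟩ y
      rw [hcomm]
      simp [h0, h2, h3]
  let S : Option (F ⊕ F × F) → Set (Alg N) := fun i => i.elim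
    (sharpAdd (span F {e₄}) (span F {e₂}))
    (Sum.elim (fun b => sharpAdd (span F {e₃ + b • e₄}) (span F {e₂}))
      (fun p => sharpAdd (span F {e₁ + p.1 • e₃ + p.2 • e₄}) (span F {e₂})))
  let v : Option (F ⊕ F × F) → Alg N := fun i => i.elim e₄
    (Sum.elim (fun b => e₃ + b • e₄) (fun p => e₁ + p.1 • e₃ + p.2 • e₄))
  have key := CC_eq_range_completeOn (F := F) S v ?_ ?_ ?_ ?_ ?_
  · refine ⟨⟨?_, fun hF => ?_⟩, key.2.2 inferInstance⟩
    · rw [key.1]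
      ext H
      constructor
      · rintro ⟨_ | b | ⟨a, b⟩, rfl⟩
        · exact Or.inl rfl
        · exact Or.inr (Or.inl ⟨b, rfl⟩)
        · exact Or.inr (Or.inr ⟨a, b, rfl⟩)
      · rintro (rfl | ⟨b, rfl⟩ | ⟨a, b, rfl⟩)
        · exact ⟨none, rfl⟩
        · exact ⟨some (Sum.inl b), rfl⟩
        · exact ⟨some (Sum.inr (a, b)), rfl⟩
    · rw [key.2.1, Finite.card_option, Nat.card_sum, Nat.card_prod]
      ring
  · rintro (_ | b | ⟨a, b⟩) x hx <;> rw [hcenter]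
    · exact fun h => (mem_sharpAdd_e₄_e₂.1 hx).1 h.2.2
    · exact fun h => (mem_sharpAdd_e₃_add_e₂.1 hx).1 h.2.1
    · exact fun h => (mem_sharpAdd_e₁_add_e₂.1 hx).1 h.1
  · rintro (_ | b | ⟨a, b⟩) x hx y hy <;> rw [hcenter] at hy <;> rw [hcomm]
    · replace hx := mem_sharpAdd_e₄_e₂.1 hx
      refine Iff.trans ?_ mem_sharpAdd_e₄_e₂.symm
      grind
    · replace hx := mem_sharpAdd_e₃_add_e₂.1 hx
      refine Iff.trans ?_ mem_sharpAdd_e₃_add_e₂.symm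
      grind
    · replace hx := mem_sharpAdd_e₁_add_e₂.1 hx
      refine Iff.trans ?_ mem_sharpAdd_e₁_add_e₂.symm
      grind
  · intro x hx
    rw [hcenter] at hx
    by_cases h0 : x 0 = 0
    · by_cases h2 : x 2 = 0
      · exact ⟨none, mem_sharpAdd_e₄_e₂.2 (by grind)⟩
      · exact ⟨some (Sum.inl (x 3 / x 2)), mem_sharpAdd_e₃_add_e₂.2
          ⟨h2, h0, by field_simp⟩⟩
    · exact ⟨some (Sum.inr (x 2 / x 0, x 3 / x 0)), mem_sharpAdd_e₁_add_e₂.2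
        ⟨h0, by field_simp, by field_simp⟩⟩
  · rintro (_ | b | ⟨a, b⟩)
    · exact mem_sharpAdd_e₄_e₂.2 (by simp [v])
    · exact mem_sharpAdd_e₃_add_e₂.2 (by simp [v])
    · exact mem_sharpAdd_e₁_add_e₂.2 (by simp [v])
  · rintro (_ | b | ⟨a, b⟩) (_ | b' | ⟨a', b'⟩) h
    · rfl
    · have h' := (mem_sharpAdd_e₃_add_e₂ (x := e₄)).1 h
      simp at h'
    · have h' := (mem_sharpAdd_e₁_add_e₂ (x := e₄)).1 h
      simp at h'
    · have h' := (mem_sharpAdd_e₄_e₂ (x := e₃ + b • e₄)).1 h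
      simp at h'
    · have h' := (mem_sharpAdd_e₃_add_e₂ (x := e₃ + b • e₄)).1 h
      simp at h'
      rw [h']
    · have h' := (mem_sharpAdd_e₁_add_e₂ (x := e₃ + b • e₄)).1 h
      simp at h'
    · have h' := (mem_sharpAdd_e₄_e₂ (x := e₁ + a • e₃ + b • e₄)).1 h
      simp at h'
    · have h' := (mem_sharpAdd_e₃_add_e₂ (x := e₁ + a • e₃ + b • e₄)).1 h
      simp at h'
    · have h' := (mem_sharpAdd_e₁_add_e₂ (x := e₁ + a • e₃ + b • e₄)).1 h
      simp at h'
      rw [h'.1, h'.2]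

theorem components_n11_of_charP_two (h2 : CharP F 2) :
    HasComponentsDisconnected F .n11
      (fun e₁ e₂ e₃ e₄ => {H | H = completeOn (sharpAdd (span F {e₄}) (span F {e₂})) ∨
        (∃ μ₄ : F, H = completeOn (sharpAdd (span F {e₃ + μ₄ • e₄}) (span F {e₂}))) ∨
        (∃ μ₃ μ₄ : F, H = completeOn (sharpAdd (span F {e₁ + μ₃ • e₃ + μ₄ • e₄})
          (span F {e₂})))})
      (fun q => q ^ 2 + q + 1) :=
  hasComponents_of_proportional fun x y => by
    rw [lie_eq_zero_iff]
    simp [coords, CharTwo.two_eq_zero, sub_eq_zero]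

theorem components_n13 (α : F) (hα : α ≠ 0) :
    HasComponentsDisconnected F (.n13 α hα)
      (fun e₁ e₂ e₃ e₄ => {H | H = completeOn (sharpAdd (span F {e₄}) (span F {e₂})) ∨
        (∃ μ₄ : F, H = completeOn (sharpAdd (span F {e₃ + μ₄ • e₄}) (span F {e₂}))) ∨
        (∃ μ₃ μ₄ : F, H = completeOn (sharpAdd (span F {e₁ + μ₃ • e₃ + μ₄ • e₄})
          (span F {e₂})))})
      (fun q => q ^ 2 + q + 1) :=
  hasComponents_of_proportional fun x y => by
    rw [lie_eq_zero_iff]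
    simp [coords, hα, sub_eq_zero]
    tauto

end Projective

/-! ### Components of which one is not complete -/

section Mixed

variable {F : Type u} [Field F]

theorem connected_of_adj {L : Type u} {H : GraphIn L} {c : L} (hc : c ∈ H.verts)
    (h : ∀ x ∈ H.verts, x ≠ c → H.Adj c x) : H.Connected :=
  connected_of_reachable hc fun x hx => by
    by_cases hxc : x = c
    · subst hxc
      exact SimpleGraph.Reachable.refl _
    · exact reachable_of_adj (h x hx hxc)

/-- A variant of `CC_eq_range_completeOn` with one further component `H₀`, of any shape. -/
theorem CC_eq_insert_completeOn {L : Type u} [LieRing L] [LieAlgebra F L] {ι : Type*}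
    (H₀ : GraphIn L) (v₀ : L) (S : ι → Set L) (v : ι → L)
    (hconn₀ : H₀.Connected) (hle₀ : H₀ ≤ commutingGraph F L)
    (hclosed₀ : ∀ x ∈ H₀.verts, ∀ y, (commutingGraph F L).Adj x y → H₀.Adj x y)
    (hS : ∀ i, ∀ x ∈ S i, x ∉ LieAlgebra.center F L)
    (hcomm : ∀ i, ∀ x ∈ S i, ∀ y ∉ LieAlgebra.center F L, ⁅x, y⁆ = 0 ↔ y ∈ S i)
    (hcover : ∀ x ∉ LieAlgebra.center F L, x ∈ H₀.verts ∨ ∃ i, x ∈ S i)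
    (hv₀ : v₀ ∈ H₀.verts) (hv₀S : ∀ i, v₀ ∉ S i) (hv : ∀ i, v i ∈ S i)
    (hvH₀ : ∀ i, v i ∉ H₀.verts) (hinj : ∀ i j, v i ∈ S j → i = j) :
    CC F L = {H | H = H₀ ∨ ∃ i, H = completeOn (S i)} ∧
      (CC F L).ncard = Nat.card (Option ι) ∧
      (Nonempty ι → ¬ (commutingGraph F L).Connected) := by
  have key := CC_eq_range (F := F) (ι := Option ι)
    (fun i => i.elim H₀ fun i => completeOn (S i)) (fun i => i.elim v₀ v) ?_ ?_ ?_ ?_ ?_ ?_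
  · refine ⟨?_, key.2.1, fun _ => key.2.2 inferInstance⟩
    rw [key.1]
    ext H
    constructor
    · rintro ⟨_ | i, rfl⟩
      · exact Or.inl rfl
      · exact Or.inr ⟨i, rfl⟩
    · rintro (rfl | ⟨i, rfl⟩)
      · exact ⟨none, rfl⟩
      · exact ⟨some i, rfl⟩
  · rintro (_ | i)
    · exact hconn₀
    · exact completeOn_connected ⟨_, hv i⟩
  · rintro (_ | i)
    · exact hle₀
    · exact completeOn_le_commutingGraph (hS i)
        fun x hx y hy => (hcomm i x hx y (hS i y hy)).2 hy
  · rintro (_ | i) x hx y h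
    · exact hclosed₀ x hx y h
    · exact ⟨hx, (hcomm i x hx y h.2.1).1 h.2.2.2, h.2.2.1⟩
  · intro x hx
    obtain h | ⟨i, h⟩ := hcover x hx
    · exact ⟨none, h⟩
    · exact ⟨some i, h⟩
  · rintro (_ | i)
    · exact hv₀
    · exact hv i
  · rintro (_ | i) (_ | j) h
    · rfl
    · exact absurd h (hv₀S j)
    · exact absurd h (hvH₀ i)
    · rw [hinj i j h]

theorem mem_sharp_span_add_e₄ {N : Table F} {a b c : F} {x : Alg N} :
    x ∈ sharp (span F {a • e₁ + b • e₂ + c • e₃ + e₄}) ↔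
      x 3 ≠ 0 ∧ x 0 = x 3 * a ∧ x 1 = x 3 * b ∧ x 2 = x 3 * c := by
  rw [mem_sharp_span_singleton_iff fun h => by simpa using congrFun h 3]
  simp only [Alg.ext_iff]
  simp

theorem mem_sharp_span_add_e₃ {N : Table F} {a b : F} {x : Alg N} :
    x ∈ sharp (span F {a • e₁ + b • e₂ + e₃}) ↔
      x 2 ≠ 0 ∧ x 0 = x 2 * a ∧ x 1 = x 2 * b ∧ x 3 = 0 := by
  rw [mem_sharp_span_singleton_iff fun h => by simpa using congrFun h 2]
  simp only [Alg.ext_iff]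
  simp

end Mixed

/-! ### Windmills in the commuting graph -/

section Windmill

variable {F : Type u} [Field F] {N : Table F}

/-- The components when the nonzero elements of the ideal spanned by `e₁`, `e₂`, `e₃` commute
only with elements of that ideal, and the other elements only with their own multiples. -/
theorem hasComponents_of_firstThree
    (hcenter : ∀ x : Alg N, x ∈ LieAlgebra.center F (Alg N) ↔ x = 0)
    (hideal : ∀ x y : Alg N, x ≠ 0 → x 3 = 0 → (⁅x, y⁆ = 0 ↔ y 3 = 0 ∧ x 2 * y 0 = x 0 * y 2))
    (hline : ∀ x y : Alg N, x 3 ≠ 0 →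
      (⁅x, y⁆ = 0 ↔ x 3 * y 0 = x 0 * y 3 ∧ x 3 * y 1 = x 1 * y 3 ∧ x 3 * y 2 = x 2 * y 3)) :
    HasComponentsDisconnected F N
      (fun e₁ e₂ e₃ e₄ => {H | H = inducedFirstThree N ∨
        (∃ μ₁ μ₂ μ₃ : F,
          H = completeOn (sharp (span F {μ₁ • e₁ + μ₂ • e₂ + μ₃ • e₃ + e₄})))})
      (fun q => q ^ 3 + 1) := by
  have hverts : ∀ x : Alg N, x ∈ (inducedFirstThree N).verts ↔ x 3 = 0 ∧ x ≠ 0 := fun x =>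
    and_congr_left fun _ => mem_span_e₁_e₂_e₃
  have he₂ : (e₂ : Alg N) ∈ (inducedFirstThree N).verts :=
    (hverts _).2 ⟨by simp, e₂_ne_zero⟩
  have key := CC_eq_insert_completeOn (F := F) (L := Alg N) (ι := F × F × F)
    (inducedFirstThree N) e₂
    (fun p => sharp (span F {p.1 • e₁ + p.2.1 • e₂ + p.2.2 • e₃ + e₄}))
    (fun p => p.1 • e₁ + p.2.1 • e₂ + p.2.2 • e₃ + e₄) ?_ ?_ ?_ ?_ ?_ ?_ he₂ ?_ ?_ ?_ ?_
  · refine ⟨⟨?_, fun hF => ?_⟩, key.2.2 inferInstance⟩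
    · rw [key.1]
      simp only [Prod.exists]
    · rw [key.2.1, Finite.card_option, Nat.card_prod, Nat.card_prod]
      ring
  · refine connected_of_adj he₂ fun x hx hne => ⟨he₂, hx, ?_, ?_, hne.symm, ?_⟩
    · exact fun h => e₂_ne_zero ((hcenter _).1 h)
    · exact fun h => hx.2 ((hcenter _).1 h)
    · exact (hideal _ _ e₂_ne_zero (by simp)).2 ⟨((hverts x).1 hx).1, by simp⟩
  · refine ⟨fun x hx h => hx.2 ((hcenter _).1 h), fun x y h => h.2.2⟩
  · intro x hx y h
    refine ⟨hx, (hverts y).2 ⟨?_, fun h0 => h.2.1 ((hcenter _).2 h0)⟩, h⟩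
    exact ((hideal x y hx.2 ((hverts x).1 hx).1).1 h.2.2.2).1
  · intro p x hx h
    exact hx.2 ((hcenter _).1 h)
  · intro p x hx y hy
    rw [hcenter, Alg.ext_iff] at hy
    obtain ⟨h3, h⟩ := mem_sharp_span_add_e₄.1 hx
    rw [hline x y h3, mem_sharp_span_add_e₄]
    simp at hy
    grind
  · intro x hx
    rw [hcenter] at hx
    by_cases h : x 3 = 0
    · exact Or.inl ((hverts x).2 ⟨h, hx⟩)
    · refine Or.inr ⟨(x 0 / x 3, x 1 / x 3, x 2 / x 3), mem_sharp_span_add_e₄.2 ⟨h, ?_⟩⟩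
      refine ⟨?_, ?_, ?_⟩ <;> field_simp
  · intro p h
    simpa using (mem_sharp_span_add_e₄.1 h).1
  · intro p
    exact mem_sharp_span_add_e₄.2 (by simp)
  · intro p h
    simpa using ((hverts _).1 h).1
  · rintro ⟨a, b, c⟩ ⟨a', b', c'⟩ h
    simpa using (mem_sharp_span_add_e₄.1 h).2

theorem mem_sharpAdd_e₁_e₂ {x : Alg N} :
    x ∈ sharpAdd (span F {e₁}) (span F {e₂}) ↔ x 0 ≠ 0 ∧ x 2 = 0 ∧ x 3 = 0 := by
  rw [mem_sharpAdd_span_singleton_iff e₁_ne_zero]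
  simp only [mem_span_e₂]
  simp
  exact ⟨fun ⟨c, hc⟩ => by grind, fun h => ⟨x 0, by grind⟩⟩

/-- The vertex of the ideal spanned by `e₁`, `e₂`, `e₃` that corresponds to a vertex of the
windmill. The copies of the complete graph are indexed by the points of the projective line: the
first basis vector is sent to `e₁ + m e₃` for the point `m`, and to `e₃` for the point at
infinity `none`. -/
def windmillVertex (N : Table F) :
    ((Option F × sharpAdd (span F {(e₁ : Alg N)}) (span F {e₂})) ⊕
      sharp (span F {(e₂ : Alg N)})) → Alg N
  | .inl (none, s) => s.1 1 • e₂ + s.1 0 • e₃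
  | .inl (some m, s) => s.1 0 • e₁ + s.1 1 • e₂ + (m * s.1 0) • e₃
  | .inr u => u.1

theorem isWindmill_firstThree
    (hcenter : ∀ x : Alg N, x ∈ LieAlgebra.center F (Alg N) ↔ x = 0)
    (hideal : ∀ x y : Alg N, x ≠ 0 → x 3 = 0 →
      (⁅x, y⁆ = 0 ↔ y 3 = 0 ∧ x 2 * y 0 = x 0 * y 2)) :
    IsWindmill (inducedFirstThree N).coe
      (sharpAdd (span F {(e₁ : Alg N)}) (span F {e₂}))
      (sharp (span F {(e₂ : Alg N)})) (Cardinal.mk F + 1) := by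
  have hverts : ∀ x : Alg N, x ∈ (inducedFirstThree N).verts ↔ x 3 = 0 ∧ x ≠ 0 := fun x =>
    and_congr_left fun _ => mem_span_e₁_e₂_e₃
  have hS : ∀ s : sharpAdd (span F {(e₁ : Alg N)}) (span F {e₂}),
      s.1 0 ≠ 0 ∧ s.1 2 = 0 ∧ s.1 3 = 0 := fun s => mem_sharpAdd_e₁_e₂.1 s.2
  have hU : ∀ u : sharp (span F {(e₂ : Alg N)}), u.1 1 ≠ 0 ∧ u.1 0 = 0 ∧ u.1 2 = 0 ∧ u.1 3 = 0 := by
    intro u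
    have h := mem_span_e₂.1 u.2.1
    refine ⟨fun h1 => u.2.2 ?_, h⟩
    rw [Alg.ext_iff]
    simp [h, h1]
  have hmem : ∀ w, windmillVertex N w ∈ (inducedFirstThree N).verts := by
    intro w
    rw [hverts, Ne, Alg.ext_iff]
    obtain ⟨_ | m, s⟩ | u := w
    · have := hS s
      simp [windmillVertex, this]
    · have := hS s
      simp [windmillVertex, this]
    · have := hU u
      simp [windmillVertex, this]
  have hinj : Function.Injective (windmillVertex N) := by
    intro w w' h
    rw [Alg.ext_iff] at h
    obtain ⟨_ | m, s⟩ | u := w <;> obtain ⟨_ | m', s'⟩ | u' := w'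
    · have h1 := hS s
      have h2 := hS s'
      have : s = s' := Subtype.ext (Alg.ext_iff.2 (by simp [windmillVertex] at h; grind))
      rw [this]
    · have h2 := hS s'
      simp [windmillVertex] at h
      grind
    · have h1 := hS s
      have h2 := hU u'
      simp [windmillVertex] at h
      grind
    · have h2 := hS s
      simp [windmillVertex] at h
      grind
    · have h1 := hS s
      have h2 := hS s'
      simp [windmillVertex] at h
      have h3 : s = s' := Subtype.ext (Alg.ext_iff.2 (by grind))
      have h4 : m = m' := by grind
      rw [h3, h4]
    · have h1 := hS s
      have h2 := hU u'
      simp [windmillVertex] at h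
      grind
    · have h1 := hS s'
      have h2 := hU u
      simp [windmillVertex] at h
      grind
    · have h1 := hS s'
      have h2 := hU u
      simp [windmillVertex] at h
      grind
    · have : u = u' := Subtype.ext (Alg.ext_iff.2 h)
      rw [this]
  have hsurj : ∀ x ∈ (inducedFirstThree N).verts, ∃ w, windmillVertex N w = x := by
    intro x hx
    obtain ⟨h3, h0⟩ := (hverts x).1 hx
    by_cases hx0 : x 0 = 0
    · by_cases hx2 : x 2 = 0
      · exact ⟨.inr ⟨x, mem_span_e₂.2 ⟨hx0, hx2, h3⟩, h0⟩, rfl⟩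
      · refine ⟨.inl (none, ⟨x 2 • e₁ + x 1 • e₂, mem_sharpAdd_e₁_e₂.2 (by simp [hx2])⟩), ?_⟩
        rw [Alg.ext_iff]
        simp [windmillVertex, hx0, h3]
    · refine ⟨.inl (some (x 2 / x 0), ⟨x 0 • e₁ + x 1 • e₂,
        mem_sharpAdd_e₁_e₂.2 (by simp [hx0])⟩), ?_⟩
      rw [Alg.ext_iff]
      simp [windmillVertex, hx0, h3]
  let f : ((Option F × sharpAdd (span F {(e₁ : Alg N)}) (span F {e₂})) ⊕
      sharp (span F {(e₂ : Alg N)})) ≃ (inducedFirstThree N).verts :=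
    Equiv.ofBijective (fun w => ⟨windmillVertex N w, hmem w⟩)
      ⟨fun w w' h => hinj (congrArg Subtype.val h), fun x => by
        obtain ⟨w, hw⟩ := hsurj x.1 x.2
        exact ⟨w, Subtype.ext hw⟩⟩
  have hadj : ∀ w w', (inducedFirstThree N).coe.Adj (f w) (f w') ↔
      w ≠ w' ∧ (windmillVertex N w) 2 * (windmillVertex N w') 0 =
        (windmillVertex N w) 0 * (windmillVertex N w') 2 := by
    intro w w'
    have h1 := (hverts _).1 (hmem w)
    have h2 := (hverts _).1 (hmem w')
    constructor
    · rintro ⟨-, -, -, -, hne, h⟩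
      exact ⟨fun hw => hne (by rw [hw]), ((hideal _ _ h1.2 h1.1).1 h).2⟩
    · rintro ⟨hne, h⟩
      exact ⟨hmem w, hmem w', fun h => h1.2 ((hcenter _).1 h), fun h => h2.2 ((hcenter _).1 h),
        hinj.ne hne, (hideal _ _ h1.2 h1.1).2 ⟨h2.1, h⟩⟩
  refine ⟨Option F, Cardinal.mk_option, ⟨RelIso.symm ⟨f, ?_⟩⟩⟩
  intro w w'
  rw [hadj]
  obtain ⟨_ | m, s⟩ | u := w <;> obtain ⟨_ | m', s'⟩ | u' := w' <;>
    simp [windmillVertex, windmill]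
  · exact ⟨(hS s).1, (hS s').1⟩
  · exact Or.inr (hU u').2.1
  · exact ⟨(hS s).1, (hS s').1⟩
  · have h1 := hS s
    have h2 := hS s'
    grind
  · have h2 := hU u'
    grind
  · exact Or.inl (hU u).2.1
  · have h1 := hU u
    grind
  · have h1 := hU u
    grind

end Windmill

/-! ### The algebras with a windmill -/

section WindmillExamples

variable {F : Type u} [Field F]

theorem mem_center_n11_iff (h2 : (2 : F) ≠ 0) (x : Alg (.n11 : Table F)) :
    x ∈ LieAlgebra.center F (Alg (.n11 : Table F)) ↔ x = 0 := by
  rw [mem_center_iff]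
  refine ⟨fun h => ?_, fun h => by simp [h]⟩
  have h1 := lie_eq_zero_iff.1 (h e₁)
  have h4 := lie_eq_zero_iff.1 (h e₄)
  simp [coords] at h1 h4
  rw [Alg.ext_iff]
  simp
  grind

theorem lie_n11_eq_zero_iff (h2 : (2 : F) ≠ 0) (x y : Alg (.n11 : Table F)) (hx : x ≠ 0)
    (h3 : x 3 = 0) : ⁅x, y⁆ = 0 ↔ y 3 = 0 ∧ x 2 * y 0 = x 0 * y 2 := by
  rw [Ne, Alg.ext_iff] at hx
  rw [lie_eq_zero_iff]
  simp at hx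
  simp [coords]
  grind

theorem components_n11 (h2 : (2 : F) ≠ 0) :
    HasComponentsDisconnected F .n11
      (fun e₁ e₂ e₃ e₄ => {H | H = inducedFirstThree .n11 ∨
        (∃ μ₁ μ₂ μ₃ : F,
          H = completeOn (sharp (span F {μ₁ • e₁ + μ₂ • e₂ + μ₃ • e₃ + e₄})))})
      (fun q => q ^ 3 + 1) :=
  hasComponents_of_firstThree (mem_center_n11_iff h2) (lie_n11_eq_zero_iff h2) fun x y h3 => by
    rw [lie_eq_zero_iff]
    simp [coords]
    grind

theorem mem_center_n12_iff (α : F) (x : Alg (.n12 α : Table F)) :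
    x ∈ LieAlgebra.center F (Alg (.n12 α : Table F)) ↔ x = 0 := by
  rw [mem_center_iff]
  refine ⟨fun h => ?_, fun h => by simp [h]⟩
  have h1 := lie_eq_zero_iff.1 (h e₁)
  have h3 := lie_eq_zero_iff.1 (h e₃)
  have h4 := lie_eq_zero_iff.1 (h e₄)
  simp [coords] at h1 h3 h4
  rw [Alg.ext_iff]
  simp
  grind

theorem lie_n12_eq_zero_iff {α : F} (hα : α ≠ 0) (x y : Alg (.n12 α : Table F)) (hx : x ≠ 0)
    (h3 : x 3 = 0) : ⁅x, y⁆ = 0 ↔ y 3 = 0 ∧ x 2 * y 0 = x 0 * y 2 := by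
  rw [Ne, Alg.ext_iff] at hx
  rw [lie_eq_zero_iff]
  simp at hx
  simp [coords]
  grind

theorem components_n12 {α : F} (hα : α ≠ 0) :
    HasComponentsDisconnected F (.n12 α)
      (fun e₁ e₂ e₃ e₄ => {H | H = inducedFirstThree (.n12 α) ∨
        (∃ μ₁ μ₂ μ₃ : F,
          H = completeOn (sharp (span F {μ₁ • e₁ + μ₂ • e₂ + μ₃ • e₃ + e₄})))})
      (fun q => q ^ 3 + 1) :=
  hasComponents_of_firstThree (mem_center_n12_iff α) (lie_n12_eq_zero_iff hα) fun x y h3 => by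
    rw [lie_eq_zero_iff]
    simp [coords]
    grind

end WindmillExamples

/-! ### Connected commuting graphs -/

section Connected

variable {F : Type u} [Field F]

theorem commutingGraph_adj_iff {L : Type u} [LieRing L] [LieAlgebra F L]
    (hcenter : ∀ x : L, x ∈ LieAlgebra.center F L ↔ x = 0) {x y : L} :
    (commutingGraph F L).Adj x y ↔ x ≠ 0 ∧ y ≠ 0 ∧ x ≠ y ∧ ⁅x, y⁆ = 0 :=
  and_congr (not_congr (hcenter x)) (and_congr (not_congr (hcenter y)) Iff.rfl)

theorem reachable_of_lie_eq_zero {L : Type u} [LieRing L] [LieAlgebra F L] {x y : L}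
    (hx : x ∈ (commutingGraph F L).verts) (hy : y ∈ (commutingGraph F L).verts)
    (h : ⁅x, y⁆ = 0) : (commutingGraph F L).coe.Reachable ⟨x, hx⟩ ⟨y, hy⟩ := by
  by_cases hxy : x = y
  · subst hxy
    exact SimpleGraph.Reachable.refl _
  · exact reachable_of_adj (H := commutingGraph F L) ⟨hx, hy, hxy, h⟩

theorem connected_n12_zero : (commutingGraph F (Alg (.n12 0 : Table F))).Connected := by
  have hv : ∀ x : Alg (.n12 0 : Table F), x ≠ 0 →
      x ∈ (commutingGraph F (Alg (.n12 0 : Table F))).verts :=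
    fun x hx h => hx ((mem_center_n12_iff 0 x).1 h)
  refine connected_of_reachable (hv e₂ e₂_ne_zero) fun x hx => ?_
  by_cases h3 : x 3 = 0
  · refine reachable_of_lie_eq_zero _ _ ?_
    rw [lie_eq_zero_iff]
    simp [coords, h3]
  · -- the element `z` of the ideal spanned by `e₁`, `e₂`, `e₃` commutes with `x`
    obtain ⟨z, hz⟩ : ∃ z : Alg (.n12 0 : Table F),
      z = e₁ + (-(x 0 + x 2) / x 3) • e₂ - e₃ := ⟨_, rfl⟩
    have hz0 : z ≠ 0 := fun h => by simpa [hz] using congrFun h 0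
    refine (reachable_of_lie_eq_zero _ (hv z hz0) ?_).trans
      (reachable_of_lie_eq_zero (hv z hz0) _ ?_)
    · rw [lie_eq_zero_iff]
      simp [coords, hz]
    · rw [lie_eq_zero_iff]
      simp [coords, hz]
      field_simp
      ring

theorem components_n12_zero : HasComponents F (.n12 0)
    (fun _ _ _ _ => {H | H = commutingGraph F (Alg (.n12 0))}) (fun _ => 1) := by
  have h : CC F _ = _ := components_eq_singleton (connected_n12_zero (F := F))
  exact ⟨h, fun _ => by rw [h, Set.ncard_singleton]⟩

theorem mem_center_n7_iff (x : Alg (.n7 : Table F)) :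
    x ∈ LieAlgebra.center F (Alg (.n7 : Table F)) ↔ x = 0 := by
  rw [mem_center_iff]
  refine ⟨fun h => ?_, fun h => by simp [h]⟩
  have h1 := lie_eq_zero_iff.1 (h (e₁ + e₃))
  have h2 := lie_eq_zero_iff.1 (h (e₂ + e₄))
  simp [coords] at h1 h2
  rw [Alg.ext_iff]
  simp [h1, h2]

theorem lie_n7_eq_zero_iff {x y : Alg (.n7 : Table F)} :
    ⁅x, y⁆ = 0 ↔ x 0 * y 1 = x 1 * y 0 ∧ x 2 * y 3 = x 3 * y 2 := by
  rw [lie_eq_zero_iff]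
  simp [coords, sub_eq_zero]

theorem connected_n7 : (commutingGraph F (Alg (.n7 : Table F))).Connected := by
  have hv : ∀ x : Alg (.n7 : Table F), x ≠ 0 →
      x ∈ (commutingGraph F (Alg (.n7 : Table F))).verts :=
    fun x hx h => hx ((mem_center_n7_iff x).1 h)
  refine connected_of_reachable (hv e₁ e₁_ne_zero) fun x hx => ?_
  -- the component `z` of `x` in the second summand commutes with `e₁` and with `x`; if it is
  -- zero, then `e₃` can take its place
  obtain ⟨z, hz⟩ : ∃ z : Alg (.n7 : Table F), z = x 2 • e₃ + x 3 • e₄ := ⟨_, rfl⟩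
  by_cases h : x 2 = 0 ∧ x 3 = 0
  · refine (reachable_of_lie_eq_zero _ (hv e₃ e₃_ne_zero) ?_).trans
      (reachable_of_lie_eq_zero (hv e₃ e₃_ne_zero) _ ?_)
    · rw [lie_n7_eq_zero_iff]
      simp
    · rw [lie_n7_eq_zero_iff]
      simp [h]
  · have hz0 : z ≠ 0 := fun h0 => h (by
      rw [hz, Alg.ext_iff] at h0
      simpa using h0)
    refine (reachable_of_lie_eq_zero _ (hv z hz0) ?_).trans
      (reachable_of_lie_eq_zero (hv z hz0) _ ?_)
    · rw [lie_n7_eq_zero_iff]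
      simp [hz]
    · rw [lie_n7_eq_zero_iff]
      simp [hz, mul_comm]

theorem mem_span_sup_span_n7 {a b c d : F} {x : Alg (.n7 : Table F)} :
    x ∈ span F {a • e₁ + b • e₂} ⊔ span F {c • e₃ + d • e₄} ↔
      (∃ s : F, x 0 = s * a ∧ x 1 = s * b) ∧ ∃ t : F, x 2 = t * c ∧ x 3 = t * d := by
  simp only [Submodule.mem_sup, Submodule.mem_span_singleton, exists_exists_eq_and]
  simp only [Alg.ext_iff]
  constructor
  · rintro ⟨s, t, h⟩
    simp at h
    exact ⟨⟨s, h.1.symm, h.2.1.symm⟩, t, h.2.2.1.symm, h.2.2.2.symm⟩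
  · rintro ⟨⟨s, h0, h1⟩, t, h2, h3⟩
    exact ⟨s, t, by simp [h0, h1, h2, h3]⟩

/-- Two proportional vectors of the plane are multiples of a common vector. -/
theorem exists_common_line {a b c d : F} (h : a * d = b * c) :
    ∃ m n : F, (∃ s, a = s * m ∧ b = s * n) ∧ (∃ t, c = t * m ∧ d = t * n) := by
  by_cases ha : a = 0
  · by_cases hb : b = 0
    · exact ⟨c, d, ⟨0, by simp [ha, hb]⟩, 1, by simp⟩
    · have hc : c = 0 := by grind
      exact ⟨a, b, ⟨1, by simp⟩, d / b, by simp [ha, hc], by field_simp⟩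
  · exact ⟨a, b, ⟨1, by simp⟩, c / a, by field_simp, by field_simp; linear_combination h⟩

theorem iSup_completeOn_n7 :
    (⨆ (μ : Fin 4 → F) (_ : μ ≠ 0), completeOn (sharp (span F {μ 0 • (e₁ : Alg (.n7 : Table F)) +
      μ 1 • e₂} ⊔ span F {μ 2 • e₃ + μ 3 • e₄}))) = commutingGraph F (Alg (.n7 : Table F)) := by
  ext x y
  · simp only [SimpleGraph.Subgraph.verts_iSup, Set.mem_iUnion]
    constructor
    · rintro ⟨μ, hμ, hx⟩ h
      exact hx.2 ((mem_center_n7_iff x).1 h)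
    · intro h
      have hx : x ≠ 0 := fun h0 => h ((mem_center_n7_iff x).2 h0)
      exact ⟨x, hx, mem_span_sup_span_n7.2 ⟨⟨1, by simp⟩, 1, by simp⟩, hx⟩
  · simp only [SimpleGraph.Subgraph.iSup_adj]
    rw [commutingGraph_adj_iff mem_center_n7_iff, lie_n7_eq_zero_iff]
    constructor
    · rintro ⟨μ, hμ, hx, hy, hne⟩
      obtain ⟨⟨s, h0, h1⟩, t, h2, h3⟩ := mem_span_sup_span_n7.1 hx.1
      obtain ⟨⟨s', h0', h1'⟩, t', h2', h3'⟩ := mem_span_sup_span_n7.1 hy.1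
      refine ⟨hx.2, hy.2, hne, ?_, ?_⟩
      · rw [h0, h1, h0', h1']
        ring
      · rw [h2, h3, h2', h3']
        ring
    · rintro ⟨hx, hy, hne, h, h'⟩
      obtain ⟨m, n, hs, ht⟩ := exists_common_line h
      obtain ⟨m', n', hs', ht'⟩ := exists_common_line h'
      refine ⟨![m, n, m', n'], fun h0 => hx ?_,
        ⟨mem_span_sup_span_n7.2 ⟨hs, hs'⟩, hx⟩, ⟨mem_span_sup_span_n7.2 ⟨ht, ht'⟩, hy⟩, hne⟩
      have k0 := congrFun h0 0
      have k1 := congrFun h0 1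
      have k2 := congrFun h0 2
      have k3 := congrFun h0 3
      simp at k0 k1 k2 k3
      subst k0 k1 k2 k3
      obtain ⟨s, hs0, hs1⟩ := hs
      obtain ⟨t, ht0, ht1⟩ := hs'
      rw [Alg.ext_iff]
      simp_all

theorem components_n7 : HasComponents F .n7
    (fun e₁ e₂ e₃ e₄ => {H | H = ⨆ (μ : Fin 4 → F) (_ : μ ≠ 0),
      completeOn (sharp (span F {μ 0 • e₁ + μ 1 • e₂} ⊔ span F {μ 2 • e₃ + μ 3 • e₄}))})
    (fun _ => 1) := by
  have h : CC F _ = _ := components_eq_singleton (connected_n7 (F := F))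
  refine ⟨?_, fun _ => by rw [h, Set.ncard_singleton]⟩
  rw [h]
  exact congrArg (fun H => ({H} : Set (GraphIn _))) iSup_completeOn_n7.symm

end Connected

/-! ### The two-parameter family in characteristic two -/

section CharTwoFamily

variable {F : Type u} [Field F] {α β : F} {h2 : CharP F 2} {hα : α ≠ 0} {hβ : β ≠ 1}

theorem lie_n10_eq_zero_iff {x y : Alg (.n10 α β h2 hα hβ)} :
    ⁅x, y⁆ = 0 ↔ (x 3 * y 0 - x 0 * y 3) + α * (x 2 * y 1 - x 1 * y 2) = 0 ∧
      (x 2 * y 0 - x 0 * y 2) + β * (x 3 * y 1 - x 1 * y 3) = 0 ∧ x 3 * y 2 = x 2 * y 3 := by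
  have hβ' : 1 + β ≠ 0 := fun h => hβ (by
    have := CharTwo.two_eq_zero (R := F)
    linear_combination h - this)
  rw [lie_eq_zero_iff]
  simp [coords, sub_eq_zero, hβ']

theorem mem_center_n10_iff (x : Alg (.n10 α β h2 hα hβ)) :
    x ∈ LieAlgebra.center F (Alg (.n10 α β h2 hα hβ)) ↔ x = 0 := by
  rw [mem_center_iff]
  refine ⟨fun h => ?_, fun h => by simp [h]⟩
  have h1 := lie_n10_eq_zero_iff.1 (h e₁)
  have h3 := lie_n10_eq_zero_iff.1 (h e₃)
  have h4 := lie_n10_eq_zero_iff.1 (h e₄)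
  simp at h1 h3 h4
  rw [Alg.ext_iff]
  simp
  grind

/-- The action of `x` on the ideal spanned by `e₁` and `e₂` has the determinant
`α (x 2)² - β (x 3)²`, up to sign. If it is not zero, `x` commutes only with its multiples. -/
theorem lie_n10_eq_zero_iff_of_ne {x y : Alg (.n10 α β h2 hα hβ)}
    (hx : α * x 2 ^ 2 ≠ β * x 3 ^ 2) :
    ⁅x, y⁆ = 0 ↔ (x 3 * y 0 = x 0 * y 3 ∧ x 3 * y 1 = x 1 * y 3 ∧ x 3 * y 2 = x 2 * y 3) ∧
      x 2 * y 0 = x 0 * y 2 ∧ x 2 * y 1 = x 1 * y 2 := by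
  rw [lie_n10_eq_zero_iff]
  constructor
  · rintro ⟨k0, k1, k2⟩
    have hn := sub_ne_zero.2 hx
    by_cases h3 : x 3 = 0
    · have hx2 : x 2 ≠ 0 := fun h => hx (by simp [h, h3])
      have hy3 : y 3 = 0 := by grind
      grind
    · have hw : x 3 * y 1 - x 1 * y 3 = 0 := by
        refine (mul_eq_zero.1 (?_ : (α * x 2 ^ 2 - β * x 3 ^ 2) * _ = 0)).resolve_left hn
        linear_combination x 2 * x 3 * k0 - x 3 * x 3 * k1 + (α * x 1 * x 2 - x 0 * x 3) * k2
      have hu : x 3 * y 0 - x 0 * y 3 = 0 := by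
        refine (mul_eq_zero.1 (?_ : x 3 * _ = 0)).resolve_left h3
        linear_combination x 3 * k0 - α * x 2 * hw + α * x 1 * k2
      refine ⟨⟨sub_eq_zero.1 hu, sub_eq_zero.1 hw, k2⟩, ?_, ?_⟩
      · refine mul_left_cancel₀ h3 ?_
        linear_combination x 2 * hu - x 0 * k2
      · refine mul_left_cancel₀ h3 ?_
        linear_combination x 2 * hw - x 1 * k2
  · rintro ⟨⟨h0, h1, h2⟩, h3, h4⟩
    refine ⟨?_, ?_, h2⟩
    · rw [h0, h4]
      ring
    · rw [h1, h3]
      ring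

theorem lie_n10_eq_zero_iff_mem_e₄ {a b c : F} {x y : Alg (.n10 α β h2 hα hβ)}
    (hc : α * c ^ 2 ≠ β) (hx : x ∈ sharp (span F {a • e₁ + b • e₂ + c • e₃ + e₄})) (hy : y ≠ 0) :
    ⁅x, y⁆ = 0 ↔ y ∈ sharp (span F {a • e₁ + b • e₂ + c • e₃ + e₄}) := by
  obtain ⟨h3, k0, k1, k2⟩ := mem_sharp_span_add_e₄.1 hx
  rw [Ne, Alg.ext_iff] at hy
  simp at hy
  rw [lie_n10_eq_zero_iff_of_ne, mem_sharp_span_add_e₄]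
  · grind
  · rw [k2]
    intro h
    refine hc (mul_left_cancel₀ (pow_ne_zero 2 h3) ?_)
    linear_combination h

theorem lie_n10_eq_zero_iff_mem_e₃ {a b : F} {x y : Alg (.n10 α β h2 hα hβ)}
    (hx : x ∈ sharp (span F {a • e₁ + b • e₂ + e₃})) (hy : y ≠ 0) :
    ⁅x, y⁆ = 0 ↔ y ∈ sharp (span F {a • e₁ + b • e₂ + e₃}) := by
  obtain ⟨k2, k0, k1, h3⟩ := mem_sharp_span_add_e₃.1 hx
  rw [Ne, Alg.ext_iff] at hy
  simp at hy
  rw [lie_n10_eq_zero_iff_of_ne, mem_sharp_span_add_e₃]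
  · grind
  · rw [h3]
    simp [hα, k2]

/-- The components of the family, given the one that contains the ideal spanned by `e₁` and
`e₂`. The parameters of the other components are those for which the action on this ideal is
invertible. -/
theorem CC_n10 (H₀ : GraphIn (Alg (.n10 α β h2 hα hβ))) (hconn₀ : H₀.Connected)
    (hle₀ : H₀ ≤ commutingGraph F _)
    (hclosed₀ : ∀ x ∈ H₀.verts, ∀ y, (commutingGraph F _).Adj x y → H₀.Adj x y)
    (hverts : ∀ x, x ∈ H₀.verts ↔ α * x 2 ^ 2 = β * x 3 ^ 2 ∧ x ≠ 0) :
    CC F (Alg (.n10 α β h2 hα hβ)) = {H | H = H₀ ∨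
        (∃ μ₁ μ₂ : F, H = completeOn (sharp (span F {μ₁ • e₁ + μ₂ • e₂ + e₃}))) ∨
        (∃ μ₁ μ₂ μ₃ : F, α * μ₃ ^ 2 ≠ β ∧
          H = completeOn (sharp (span F {μ₁ • e₁ + μ₂ • e₂ + μ₃ • e₃ + e₄})))} ∧
      (CC F (Alg (.n10 α β h2 hα hβ))).ncard =
        Nat.card (Option ((F × F) ⊕ {μ : F × F × F // α * μ.2.2 ^ 2 ≠ β})) ∧
      ¬ (commutingGraph F (Alg (.n10 α β h2 hα hβ))).Connected := by
  have key := CC_eq_insert_completeOn (F := F) (L := Alg (.n10 α β h2 hα hβ))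
    (ι := (F × F) ⊕ {μ : F × F × F // α * μ.2.2 ^ 2 ≠ β}) H₀ e₁
    (Sum.elim (fun p => sharp (span F {p.1 • e₁ + p.2 • e₂ + e₃}))
      (fun p => sharp (span F {p.1.1 • e₁ + p.1.2.1 • e₂ + p.1.2.2 • e₃ + e₄})))
    (Sum.elim (fun p => p.1 • e₁ + p.2 • e₂ + e₃)
      (fun p => p.1.1 • e₁ + p.1.2.1 • e₂ + p.1.2.2 • e₃ + e₄))
    hconn₀ hle₀ hclosed₀ ?_ ?_ ?_ ((hverts _).2 ⟨by simp, e₁_ne_zero⟩) ?_ ?_ ?_ ?_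
  · refine ⟨?_, key.2.1, key.2.2 inferInstance⟩
    rw [key.1]
    simp only [Sum.exists, Sum.elim_inl, Sum.elim_inr, Prod.exists, Subtype.exists, exists_prop]
  · rintro (p | p) x hx h <;> exact hx.2 ((mem_center_n10_iff x).1 h)
  · rintro (p | p) x hx y hy <;> rw [mem_center_n10_iff] at hy
    · exact lie_n10_eq_zero_iff_mem_e₃ hx hy
    · exact lie_n10_eq_zero_iff_mem_e₄ p.2 hx hy
  · intro x hx
    rw [mem_center_n10_iff] at hx
    by_cases h : α * x 2 ^ 2 = β * x 3 ^ 2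
    · exact Or.inl ((hverts x).2 ⟨h, hx⟩)
    · right
      by_cases h3 : x 3 = 0
      · have hx2 : x 2 ≠ 0 := fun h' => h (by simp [h', h3])
        exact ⟨Sum.inl (x 0 / x 2, x 1 / x 2), mem_sharp_span_add_e₃.2
          ⟨hx2, by field_simp, by field_simp, h3⟩⟩
      · refine ⟨Sum.inr ⟨(x 0 / x 3, x 1 / x 3, x 2 / x 3), fun h' => h ?_⟩,
          mem_sharp_span_add_e₄.2 ⟨h3, by field_simp, by field_simp, by field_simp⟩⟩
        field_simp at h'
        linear_combination h'
  · rintro (p | p) h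
    · simpa using (mem_sharp_span_add_e₃.1 h).1
    · simpa using (mem_sharp_span_add_e₄.1 h).1
  · rintro (p | p)
    · exact mem_sharp_span_add_e₃.2 (by simp)
    · exact mem_sharp_span_add_e₄.2 (by simp)
  · rintro (p | p) h
    · have := ((hverts (p.1 • e₁ + p.2 • e₂ + e₃)).1 h).1
      simp [hα] at this
    · have := ((hverts (p.1.1 • e₁ + p.1.2.1 • e₂ + p.1.2.2 • e₃ + e₄)).1 h).1
      simp [p.2] at this
  · rintro (⟨a, b⟩ | ⟨⟨a, b, c⟩, hc⟩) (⟨a', b'⟩ | ⟨⟨a', b', c'⟩, hc'⟩) h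
    · have := (mem_sharp_span_add_e₃ (x := a • e₁ + b • e₂ + e₃)).1 h
      simp at this
      rw [this.1, this.2]
    · have := (mem_sharp_span_add_e₄ (x := a • e₁ + b • e₂ + e₃)).1 h
      simp at this
    · have := (mem_sharp_span_add_e₃ (x := a • e₁ + b • e₂ + c • e₃ + e₄)).1 h
      simp at this
    · have := (mem_sharp_span_add_e₄ (x := a • e₁ + b • e₂ + c • e₃ + e₄)).1 h
      simp at this
      simp [this]

theorem components_n10_of_not_sq (hsq : ∀ γ : F, α * β ≠ γ ^ 2) :
    HasComponentsDisconnected F (.n10 α β h2 hα hβ)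
      (fun e₁ e₂ e₃ e₄ => {H | H = completeOn (sharp (span F {e₁, e₂})) ∨
        (∃ μ₁ μ₂ : F, H = completeOn (sharp (span F {μ₁ • e₁ + μ₂ • e₂ + e₃}))) ∨
        (∃ μ₁ μ₂ μ₃ : F,
          H = completeOn (sharp (span F {μ₁ • e₁ + μ₂ • e₂ + μ₃ • e₃ + e₄})))})
      (fun q => q ^ 3 + q ^ 2 + 1) := by
  have hne : ∀ a b : F, α * a ^ 2 = β * b ^ 2 → a = 0 ∧ b = 0 := by
    intro a b h
    by_cases hb : b = 0
    · simp_all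
    · refine absurd ?_ (hsq (α * a / b))
      field_simp
      linear_combination -h
  have hc : ∀ c : F, α * c ^ 2 ≠ β := fun c h => by
    simpa using (hne c 1 (by rw [h]; ring)).2
  have hverts : ∀ x : Alg (.n10 α β h2 hα hβ), x ∈ (completeOn (sharp (span F {e₁, e₂}))).verts ↔
      α * x 2 ^ 2 = β * x 3 ^ 2 ∧ x ≠ 0 := by
    intro x
    refine and_congr_left fun _ => mem_span_e₁_e₂.trans ⟨fun h => by simp [h], hne _ _⟩
  have key := CC_n10 (completeOn (sharp (span F {e₁, e₂}))) ?_ ?_ ?_ hverts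
  · obtain ⟨k1, k2, k3⟩ := key
    refine ⟨⟨?_, fun hF => ?_⟩, k3⟩
    · rw [k1]
      simp [hc]
    · rw [k2, Finite.card_option, Nat.card_sum, Nat.card_congr (Equiv.subtypeUnivEquiv
        fun μ : F × F × F => hc μ.2.2), Nat.card_prod, Nat.card_prod, Nat.card_prod]
      ring
  · exact completeOn_connected ⟨e₁, mem_span_e₁_e₂.2 (by simp), e₁_ne_zero⟩
  · refine completeOn_le_commutingGraph (fun x hx h => hx.2 ((mem_center_n10_iff x).1 h)) ?_
    intro x hx y hy
    rw [lie_n10_eq_zero_iff]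
    simp [mem_span_e₁_e₂.1 hx.1, mem_span_e₁_e₂.1 hy.1]
  · intro x hx y h
    rw [commutingGraph_adj_iff mem_center_n10_iff] at h
    refine ⟨hx, (hverts y).2 ⟨by_contra fun hy => h.1 ?_, h.2.1⟩, h.2.2.1⟩
    -- otherwise `x` would be a multiple of `y`
    have hxy := (lie_n10_eq_zero_iff_of_ne hy).1 (by rw [← lie_skew, h.2.2.2, neg_zero])
    have hx' := mem_span_e₁_e₂.1 hx.1
    rw [Alg.ext_iff]
    simp [hx'] at hxy ⊢
    grind

theorem mem_span_sup_span_n10 {a b c d : F} {x : Alg (.n10 α β h2 hα hβ)} :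
    x ∈ span F {c • e₁ + e₂} ⊔ span F {a • e₁ + b • e₂ + c • e₃ + d • e₄} ↔
      ∃ s t : F, x 0 = s * c + t * a ∧ x 1 = s + t * b ∧ x 2 = t * c ∧ x 3 = t * d := by
  simp only [Submodule.mem_sup, Submodule.mem_span_singleton, exists_exists_eq_and]
  simp only [Alg.ext_iff]
  refine exists_congr fun s => exists_congr fun t => ?_
  simp [eq_comm]

theorem components_n10_of_sq {γ : F} (hγ : α * β = γ ^ 2) :
    HasComponentsDisconnected F (.n10 α β h2 hα hβ)
      (fun e₁ e₂ e₃ e₄ => {H | H = (completeOn (sharp (span F {e₁, e₂})) ⊔ ⨆ (μ₁ : F) (μ₂ : F),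
          completeOn (sharp (span F {γ • e₁ + e₂} ⊔
            span F {μ₁ • e₁ + μ₂ • e₂ + γ • e₃ + α • e₄}))) ∨
        (∃ μ₁ μ₂ : F, H = completeOn (sharp (span F {μ₁ • e₁ + μ₂ • e₂ + e₃}))) ∨
        (∃ μ₁ μ₂ μ₃ : F, α * μ₃ ^ 2 ≠ β ∧
          H = completeOn (sharp (span F {μ₁ • e₁ + μ₂ • e₂ + μ₃ • e₃ + e₄})))})
      (fun q => q ^ 3 + 1) := by
  have htwo : (2 : F) = 0 := CharTwo.two_eq_zero
  have hcond : ∀ a b : F, α * a ^ 2 = β * b ^ 2 ↔ α * a = γ * b := by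
    intro a b
    have h1 : α * (α * a ^ 2 - β * b ^ 2) = (α * a - γ * b) ^ 2 := by
      linear_combination - b ^ 2 * hγ + (α * a * γ * b - γ ^ 2 * b ^ 2) * htwo
    rw [← sub_eq_zero, ← sub_eq_zero (a := α * a),
      ← pow_eq_zero_iff (a := α * a - γ * b) two_ne_zero, ← h1]
    simp [hα]
  obtain ⟨M, hM⟩ : ∃ M : F → F → Set (Alg (.n10 α β h2 hα hβ)), M = fun μ₁ μ₂ =>
      sharp (span F {γ • e₁ + e₂} ⊔ span F {μ₁ • e₁ + μ₂ • e₂ + γ • e₃ + α • e₄}) := ⟨_, rfl⟩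
  have hmemM : ∀ a b x, x ∈ M a b ↔
      (∃ s t : F, x 0 = s * γ + t * a ∧ x 1 = s + t * b ∧ x 2 = t * γ ∧ x 3 = t * α) ∧ x ≠ 0 :=
    fun a b x => by
      rw [hM]
      exact and_congr_left fun _ => mem_span_sup_span_n10
  obtain ⟨H₀, hH₀⟩ : ∃ H₀ : GraphIn (Alg (.n10 α β h2 hα hβ)), H₀ =
      completeOn (sharp (span F {e₁, e₂})) ⊔ ⨆ (μ₁ : F) (μ₂ : F), completeOn (M μ₁ μ₂) :=
    ⟨_, rfl⟩
  have hadj : ∀ x y, H₀.Adj x y ↔ x ≠ y ∧ (x ∈ sharp (span F {e₁, e₂}) ∧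
      y ∈ sharp (span F {e₁, e₂}) ∨ ∃ a b, x ∈ M a b ∧ y ∈ M a b) := by
    intro x y
    rw [hH₀, SimpleGraph.Subgraph.sup_adj]
    simp only [SimpleGraph.Subgraph.iSup_adj, completeOn]
    grind
  have hverts : ∀ x, x ∈ H₀.verts ↔ α * x 2 ^ 2 = β * x 3 ^ 2 ∧ x ≠ 0 := by
    intro x
    rw [hH₀, SimpleGraph.Subgraph.verts_sup, hcond]
    simp only [SimpleGraph.Subgraph.verts_iSup, completeOn, Set.mem_union, Set.mem_iUnion]
    constructor
    · rintro (hx | ⟨a, b, hx⟩)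
      · refine ⟨?_, hx.2⟩
        simp [mem_span_e₁_e₂.1 hx.1]
      · obtain ⟨⟨s, t, -, -, h2, h3⟩, h0⟩ := (hmemM a b x).1 hx
        refine ⟨?_, h0⟩
        rw [h2, h3]
        ring
    · rintro ⟨h, h0⟩
      by_cases h3 : x 3 = 0
      · exact Or.inl ⟨mem_span_e₁_e₂.2 ⟨by simpa [h3, hα] using h, h3⟩, h0⟩
      · refine Or.inr ⟨α * x 0 / x 3, α * x 1 / x 3, (hmemM _ _ x).2 ⟨⟨0, x 3 / α, ?_⟩, h0⟩⟩
        refine ⟨by field_simp; ring, by field_simp; ring, ?_, by field_simp⟩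
        field_simp
        linear_combination h
  have hc₀ : (γ • e₁ + e₂ : Alg (.n10 α β h2 hα hβ)) ≠ 0 := fun h => by
    simpa using congrFun h 1
  have key := CC_n10 H₀ ?_ ?_ ?_ hverts
  · obtain ⟨k1, k2, k3⟩ := key
    refine ⟨⟨?_, fun hF => ?_⟩, k3⟩
    · rw [k1, hH₀, hM]
    · -- the missing value `γ / α` of `μ₃` leaves room for the first family
      let f : (F × F) ⊕ {μ : F × F × F // α * μ.2.2 ^ 2 ≠ β} → F × F × F :=
        Sum.elim (fun p => (p.1, p.2, γ / α)) Subtype.val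
      have hγα : α * (γ / α) ^ 2 = β := by
        field_simp
        exact hγ.symm
      have huniq : ∀ c, α * c ^ 2 = β → c = γ / α := fun c hc => by
        have := (hcond c 1).1 (by rw [hc]; ring)
        field_simp
        linear_combination this
      have hf : Function.Bijective f := by
        constructor
        · rintro (⟨a, b⟩ | ⟨⟨a, b, c⟩, hc⟩) (⟨a', b'⟩ | ⟨⟨a', b', c'⟩, hc'⟩) h <;>
            simp [f] at h
          · rw [h.1, h.2]
          · exact absurd (h.2.2 ▸ hγα) hc'
          · exact absurd (h.2.2 ▸ hγα) hc
          · simp [h]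
        · rintro ⟨a, b, c⟩
          by_cases hc : α * c ^ 2 = β
          · exact ⟨Sum.inl (a, b), by rw [huniq c hc]; rfl⟩
          · exact ⟨Sum.inr ⟨(a, b, c), hc⟩, rfl⟩
      rw [k2, Finite.card_option, Nat.card_eq_of_bijective f hf, Nat.card_prod, Nat.card_prod]
      ring
  · refine connected_of_adj (c := γ • e₁ + e₂) ((hverts _).2 ⟨by simp, hc₀⟩) ?_
    intro x hx hne
    rw [hverts, hcond] at hx
    rw [hadj]
    refine ⟨hne.symm, ?_⟩
    by_cases h3 : x 3 = 0
    · refine Or.inl ⟨⟨mem_span_e₁_e₂.2 (by simp), hc₀⟩, ?_, hx.2⟩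
      exact mem_span_e₁_e₂.2 ⟨by simpa [h3, hα] using hx.1, h3⟩
    · refine Or.inr ⟨α * x 0 / x 3, α * x 1 / x 3, (hmemM _ _ _).2 ⟨⟨1, 0, by simp⟩, hc₀⟩,
        (hmemM _ _ x).2 ⟨⟨0, x 3 / α, ?_⟩, hx.2⟩⟩
      refine ⟨by field_simp; ring, by field_simp; ring, ?_, by field_simp⟩
      field_simp
      linear_combination hx.1
  · refine ⟨fun x hx h => ((hverts x).1 hx).2 ((mem_center_n10_iff x).1 h), fun x y h => ?_⟩
    rw [commutingGraph_adj_iff mem_center_n10_iff]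
    refine ⟨((hverts x).1 h.fst_mem).2, ((hverts y).1 h.snd_mem).2, h.ne, ?_⟩
    rw [hadj] at h
    rw [lie_n10_eq_zero_iff]
    obtain ⟨-, ⟨hx, hy⟩ | ⟨a, b, hx, hy⟩⟩ := h
    · simp [mem_span_e₁_e₂.1 hx.1, mem_span_e₁_e₂.1 hy.1]
    · obtain ⟨⟨s, t, h0, h1, h2, h3⟩, -⟩ := (hmemM a b x).1 hx
      obtain ⟨⟨s', t', h0', h1', h2', h3'⟩, -⟩ := (hmemM a b y).1 hy
      rw [h0, h1, h2, h3, h0', h1', h2', h3']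
      refine ⟨?_, ?_, by ring⟩
      · linear_combination α * γ * (t * s' - s * t') * htwo
      · linear_combination (t * s' - s * t') * hγ + γ ^ 2 * (t * s' - s * t') * htwo
  · intro x hx y h
    rw [hverts, hcond] at hx
    rw [commutingGraph_adj_iff mem_center_n10_iff] at h
    obtain ⟨hx0, hy0, hne, hxy⟩ := h
    rw [hadj]
    refine ⟨hne, ?_⟩
    obtain ⟨l0, l1, l2⟩ := lie_n10_eq_zero_iff.1 hxy
    by_cases h3 : x 3 = 0
    · have hx2 : x 2 = 0 := by simpa [h3, hα] using hx.1
      -- otherwise `x` would be a multiple of `y`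
      have hy : α * y 2 = γ * y 3 := by
        rw [← hcond]
        refine by_contra fun hy => hx0 ?_
        have hxy := (lie_n10_eq_zero_iff_of_ne hy).1 (by rw [← lie_skew, hxy, neg_zero])
        rw [Alg.ext_iff]
        simp [h3, hx2] at hxy ⊢
        grind
      by_cases hy3 : y 3 = 0
      · exact Or.inl ⟨⟨mem_span_e₁_e₂.2 ⟨hx2, h3⟩, hx0⟩,
          mem_span_e₁_e₂.2 ⟨by simpa [hy3, hα] using hy, hy3⟩, hy0⟩
      · have hx01 : x 0 = γ * x 1 := by
          refine mul_left_cancel₀ hy3 ?_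
          rw [h3, hx2] at l0
          linear_combination -l0 - x 1 * hy - y 3 * γ * x 1 * htwo
        refine Or.inr ⟨α * y 0 / y 3, α * y 1 / y 3, (hmemM _ _ x).2 ⟨⟨x 1, 0, ?_⟩, hx0⟩,
          (hmemM _ _ y).2 ⟨⟨0, y 3 / α, ?_⟩, hy0⟩⟩
        · simp [hx01, hx2, h3, mul_comm]
        · refine ⟨by field_simp; ring, by field_simp; ring, ?_, by field_simp⟩
          field_simp
          linear_combination hy
    · refine Or.inr ⟨α * x 0 / x 3, α * x 1 / x 3, (hmemM _ _ x).2 ⟨⟨0, x 3 / α, ?_⟩, hx0⟩,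
        (hmemM _ _ y).2 ⟨⟨(x 3 * y 1 - x 1 * y 3) / x 3, y 3 / α, ?_⟩, hy0⟩⟩
      · refine ⟨by field_simp; ring, by field_simp; ring, ?_, by field_simp⟩
        field_simp
        linear_combination hx.1
      · refine ⟨?_, ?_, ?_, ?_⟩
        · have hu : x 3 * y 0 - x 0 * y 3 = γ * (x 3 * y 1 - x 1 * y 3) := by
            refine mul_left_cancel₀ h3 ?_
            linear_combination x 3 * l0 + α * x 1 * l2 - (x 3 * y 1 - x 1 * y 3) * hx.1
              - x 3 * γ * (x 3 * y 1 - x 1 * y 3) * htwo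
          field_simp
          linear_combination hu
        · field_simp
          ring
        · field_simp
          refine mul_left_cancel₀ h3 ?_
          linear_combination α * l2 + y 3 * hx.1
        · field_simp

end CharTwoFamily

theorem charP_two_iff {F : Type u} [Field F] : CharP F 2 ↔ (2 : F) = 0 :=
  ⟨fun _ => CharTwo.two_eq_zero, CharTwo.of_one_ne_zero_of_two_eq_zero one_ne_zero⟩

theorem connected_iff {F : Type u} [Field F] (N : Table F) :
    (commutingGraph F (Alg N)).Connected ↔ N = .n7 ∨ N = .n12 0 := by
  refine ⟨fun h => ?_, ?_⟩
  · cases N with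
    | n1 => exact absurd h components_n1.2
    | n2 α =>
      by_cases hα : α = 0
      · subst hα
        exact absurd h components_n2_zero.2
      · exact absurd h (components_n2 hα).2
    | n3 => exact absurd h components_n3.2
    | n4 => exact absurd h components_n4.2
    | n5 α β =>
      by_cases hα : α = 0
      · subst hα
        by_cases hβ : β = 0
        · subst hβ
          exact absurd h components_n5_zero_zero.2
        · exact absurd h (components_n5_zero hβ).2
      · exact absurd h (components_n5 hα).2
    | n6 α β =>
      by_cases hα : α = 0
      · subst hα
        by_cases hβ : β = 0
        · subst hβ
          exact absurd h components_n6_zero_zero.2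
        · exact absurd h (components_n6_zero hβ).2
      · exact absurd h (components_n6 hα).2
    | n7 => exact Or.inl rfl
    | n8 α hα => exact absurd h (components_n8 α hα).2
    | n9 α h2 hα => exact absurd h (components_n9 α h2 hα).2
    | n10 α β h2 hα hβ =>
      by_cases hγ : ∃ γ : F, α * β = γ ^ 2
      · obtain ⟨γ, hγ⟩ := hγ
        exact absurd h (components_n10_of_sq hγ).2
      · exact absurd h (components_n10_of_not_sq (not_exists.1 hγ)).2
    | n11 =>
      by_cases h2 : (2 : F) = 0
      · exact absurd h (components_n11_of_charP_two (charP_two_iff.2 h2)).2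
      · exact absurd h (components_n11 h2).2
    | n12 α =>
      by_cases hα : α = 0
      · subst hα
        exact Or.inr rfl
      · exact absurd h (components_n12 hα).2
    | n13 α hα => exact absurd h (components_n13 α hα).2
  · rintro (rfl | rfl)
    · exact connected_n7
    · exact connected_n12_zero

end SolvLie

theorem mainTheorem1 (F : Type u) [Field F] :
    HasComponents F .n1
      (fun e₁ e₂ e₃ e₄ => {H | H = completeOn (sharp (span F {e₁, e₂, e₃})) ∨
        (∃ μ₁ μ₂ μ₃ : F, H = completeOn (sharp (span F {μ₁ • e₁ + μ₂ • e₂ + μ₃ • e₃ + e₄})))})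
      (fun q => q ^ 3 + 1) ∧
    HasComponents F (.n2 0)
      (fun e₁ e₂ e₃ e₄ => {H | H = completeOn (sharpAdd (span F {e₁, e₃}) (span F {e₂ - e₃})) ∨
        (∃ μ₁ μ₃ : F, H = completeOn (sharpAdd (span F {μ₁ • e₁ + μ₃ • e₃ + e₄}) (span F {e₂ - e₃})))})
      (fun q => q ^ 2 + 1) ∧
    (∀ α : F, α ≠ 0 →
      HasComponents F (.n2 α)
        (fun e₁ e₂ e₃ e₄ => {H | H = completeOn (sharp (span F {e₁, e₂, e₃})) ∨
          (∃ μ₁ μ₂ μ₃ : F, H = completeOn (sharp (span F {μ₁ • e₁ + μ₂ • e₂ + μ₃ • e₃ + e₄})))})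
        (fun q => q ^ 3 + 1)) ∧
    HasComponents F .n3
      (fun e₁ e₂ e₃ e₄ => {H | H = completeOn (sharpAdd (span F {e₃}) (span F {e₁, e₂ - e₃})) ∨
        (∃ μ₃ : F, H = completeOn (sharpAdd (span F {μ₃ • e₃ + e₄}) (span F {e₁, e₂ - e₃})))})
      (fun q => q + 1) ∧
    HasComponents F .n4
      (fun e₁ e₂ e₃ e₄ => {H | H = completeOn (sharpAdd (span F {e₂}) (span F {e₁, e₃})) ∨
        (∃ μ₂ : F, H = completeOn (sharpAdd (span F {μ₂ • e₂ + e₄}) (span F {e₁, e₃})))})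
      (fun q => q + 1) ∧
    HasComponents F (.n5 0 0)
      (fun e₁ e₂ e₃ e₄ => {H | H = completeOn (sharpAdd (span F {e₁, e₂}) (span F {e₂ - e₃})) ∨
        (∃ μ₁ μ₂ : F, H = completeOn (sharpAdd (span F {μ₁ • e₁ + μ₂ • e₂ + e₄}) (span F {e₂ - e₃})))})
      (fun q => q ^ 2 + 1) ∧
    (∀ β : F, β ≠ 0 →
      HasComponents F (.n5 0 β)
        (fun e₁ e₂ e₃ e₄ => {H | H = completeOn (sharpAdd (span F {e₂, e₃}) (span F {β • e₁ + e₂ - e₃})) ∨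
          (∃ μ₂ μ₃ : F, H = completeOn (sharpAdd (span F {μ₂ • e₂ + μ₃ • e₃ + e₄}) (span F {β • e₁ + e₂ - e₃})))})
        (fun q => q ^ 2 + 1)) ∧
    (∀ α β : F, α ≠ 0 →
      HasComponents F (.n5 α β)
        (fun e₁ e₂ e₃ e₄ => {H | H = completeOn (sharp (span F {e₁, e₂, e₃})) ∨
          (∃ μ₁ μ₂ μ₃ : F, H = completeOn (sharp (span F {μ₁ • e₁ + μ₂ • e₂ + μ₃ • e₃ + e₄})))})
        (fun q => q ^ 3 + 1)) ∧
    HasComponents F (.n6 0 0)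
      (fun e₁ e₂ e₃ e₄ => {H | H = completeOn (sharpAdd (span F {e₁, e₂}) (span F {e₃})) ∨
        (∃ μ₁ μ₂ : F, H = completeOn (sharpAdd (span F {μ₁ • e₁ + μ₂ • e₂ + e₄}) (span F {e₃})))})
      (fun q => q ^ 2 + 1) ∧
    (∀ β : F, β ≠ 0 →
      HasComponents F (.n6 0 β)
        (fun e₁ e₂ e₃ e₄ => {H | H = completeOn (sharpAdd (span F {e₂, e₃}) (span F {β • e₁ - e₃})) ∨
          (∃ μ₂ μ₃ : F, H = completeOn (sharpAdd (span F {μ₂ • e₂ + μ₃ • e₃ + e₄}) (span F {β • e₁ - e₃})))})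
        (fun q => q ^ 2 + 1)) ∧
    (∀ α β : F, α ≠ 0 →
      HasComponents F (.n6 α β)
        (fun e₁ e₂ e₃ e₄ => {H | H = completeOn (sharp (span F {e₁, e₂, e₃})) ∨
          (∃ μ₁ μ₂ μ₃ : F, H = completeOn (sharp (span F {μ₁ • e₁ + μ₂ • e₂ + μ₃ • e₃ + e₄})))})
        (fun q => q ^ 3 + 1)) ∧
    HasComponents F .n7
      (fun e₁ e₂ e₃ e₄ => {H | H = ⨆ (μ : Fin 4 → F) (_ : μ ≠ 0),
        completeOn (sharp (span F {μ 0 • e₁ + μ 1 • e₂} ⊔ span F {μ 2 • e₃ + μ 3 • e₄}))})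
      (fun _ => 1) ∧
    (∀ (α : F) (hα : ∀ T : F, T ^ 2 - T - α ≠ 0),
      HasComponents F (.n8 α hα)
        (fun e₁ e₂ e₃ e₄ => {H | H = completeOn (sharp (span F {e₁, e₂})) ∨
          H = completeOn (sharp (span F {e₃, e₄})) ∨
          (∃ μ₃ μ₄ : F, H = completeOn (sharp (span F {e₁ + μ₃ • e₃ + μ₄ • e₄,
              e₂ + (μ₄ - μ₃ / α) • e₃ + (μ₃ / α) • e₄})))})
        (fun q => q ^ 2 + 1)) ∧
    (∀ (α : F) (h2 : CharP F 2) (hα : ∀ γ : F, α ≠ γ ^ 2),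
      HasComponents F (.n9 α h2 hα)
        (fun e₁ e₂ e₃ e₄ => {H | H = completeOn (sharp (span F {e₁, e₂})) ∨
          H = completeOn (sharp (span F {e₃, e₄})) ∨
          (∃ μ₃ μ₄ : F, H = completeOn (sharp (span F {e₁ + μ₃ • e₃ + μ₄ • e₄,
              e₂ + (α * μ₄) • e₃ + μ₃ • e₄})))})
        (fun q => q ^ 2 + 1)) ∧
    (∀ (α β : F) (h2 : CharP F 2) (hα : α ≠ 0) (hβ : β ≠ 1), (∀ γ : F, α * β ≠ γ ^ 2) →
      HasComponents F (.n10 α β h2 hα hβ)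
        (fun e₁ e₂ e₃ e₄ => {H | H = completeOn (sharp (span F {e₁, e₂})) ∨
          (∃ μ₁ μ₂ : F, H = completeOn (sharp (span F {μ₁ • e₁ + μ₂ • e₂ + e₃}))) ∨
          (∃ μ₁ μ₂ μ₃ : F, H = completeOn (sharp (span F {μ₁ • e₁ + μ₂ • e₂ + μ₃ • e₃ + e₄})))})
        (fun q => q ^ 3 + q ^ 2 + 1)) ∧
    (∀ (α β : F) (h2 : CharP F 2) (hα : α ≠ 0) (hβ : β ≠ 1) (γ : F), α * β = γ ^ 2 →
      HasComponents F (.n10 α β h2 hα hβ)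
        (fun e₁ e₂ e₃ e₄ => {H | H = (completeOn (sharp (span F {e₁, e₂})) ⊔ ⨆ (μ₁ : F) (μ₂ : F),
            completeOn (sharp (span F {γ • e₁ + e₂} ⊔
              span F {μ₁ • e₁ + μ₂ • e₂ + γ • e₃ + α • e₄}))) ∨
          (∃ μ₁ μ₂ : F, H = completeOn (sharp (span F {μ₁ • e₁ + μ₂ • e₂ + e₃}))) ∨
          (∃ μ₁ μ₂ μ₃ : F, α * μ₃ ^ 2 ≠ β ∧ H = completeOn (sharp (span F {μ₁ • e₁ + μ₂ • e₂ + μ₃ • e₃ + e₄})))})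
        (fun q => q ^ 3 + 1)) ∧
    (CharP F 2 →
      HasComponents F .n11
        (fun e₁ e₂ e₃ e₄ => {H | H = completeOn (sharpAdd (span F {e₄}) (span F {e₂})) ∨
          (∃ μ₄ : F, H = completeOn (sharpAdd (span F {e₃ + μ₄ • e₄}) (span F {e₂}))) ∨
          (∃ μ₃ μ₄ : F, H = completeOn (sharpAdd (span F {e₁ + μ₃ • e₃ + μ₄ • e₄}) (span F {e₂})))})
        (fun q => q ^ 2 + q + 1)) ∧
    (¬ CharP F 2 →
      HasComponents F .n11
        (fun e₁ e₂ e₃ e₄ => {H | H = inducedFirstThree .n11 ∨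
          (∃ μ₁ μ₂ μ₃ : F, H = completeOn (sharp (span F {μ₁ • e₁ + μ₂ • e₂ + μ₃ • e₃ + e₄})))})
        (fun q => q ^ 3 + 1) ∧
      IsWindmill (inducedFirstThree (.n11 : Table F)).coe
        (sharpAdd (span F {(e₁ : Alg (.n11 : Table F))}) (span F {e₂}))
        (sharp (span F {(e₂ : Alg (.n11 : Table F))}))
        (Cardinal.mk F + 1)) ∧
    (∀ α : F, α ≠ 0 →
      HasComponents F (.n12 α)
        (fun e₁ e₂ e₃ e₄ => {H | H = inducedFirstThree (.n12 α) ∨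
          (∃ μ₁ μ₂ μ₃ : F, H = completeOn (sharp (span F {μ₁ • e₁ + μ₂ • e₂ + μ₃ • e₃ + e₄})))})
        (fun q => q ^ 3 + 1) ∧
      IsWindmill (inducedFirstThree (.n12 α : Table F)).coe
        (sharpAdd (span F {(e₁ : Alg (.n12 α : Table F))}) (span F {e₂}))
        (sharp (span F {(e₂ : Alg (.n12 α : Table F))}))
        (Cardinal.mk F + 1)) ∧
    HasComponents F (.n12 0)
      (fun e₁ e₂ e₃ e₄ => {H | H = commutingGraph F (Alg (.n12 0))})
      (fun _ => 1) ∧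
    (∀ (α : F) (hα : α ≠ 0),
      HasComponents F (.n13 α hα)
        (fun e₁ e₂ e₃ e₄ => {H | H = completeOn (sharpAdd (span F {e₄}) (span F {e₂})) ∨
          (∃ μ₄ : F, H = completeOn (sharpAdd (span F {e₃ + μ₄ • e₄}) (span F {e₂}))) ∨
          (∃ μ₃ μ₄ : F, H = completeOn (sharpAdd (span F {e₁ + μ₃ • e₃ + μ₄ • e₄}) (span F {e₂})))})
        (fun q => q ^ 2 + q + 1)) ∧
    (∀ N : Table F, (commutingGraph F (Alg N)).Connected ↔ N = .n7 ∨ N = .n12 0) := by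
  refine ⟨components_n1.1, components_n2_zero.1, fun α hα => (components_n2 hα).1,
    components_n3.1, components_n4.1, components_n5_zero_zero.1,
    fun β hβ => (components_n5_zero hβ).1, fun α β hα => (components_n5 hα).1,
    components_n6_zero_zero.1, fun β hβ => (components_n6_zero hβ).1,
    fun α β hα => (components_n6 hα).1, components_n7, fun α hα => (components_n8 α hα).1,
    fun α h2 hα => (components_n9 α h2 hα).1,
    fun α β h2 hα hβ hsq => (components_n10_of_not_sq hsq).1,
    fun α β h2 hα hβ γ hγ => (components_n10_of_sq hγ).1,
    fun h2 => (components_n11_of_charP_two h2).1, fun h2 => ?_, fun α hα => ?_,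
    components_n12_zero, fun α hα => (components_n13 α hα).1, connected_iff⟩
  · have h2' : (2 : F) ≠ 0 := fun h => h2 (charP_two_iff.2 h)
    exact ⟨(components_n11 h2').1,
      isWindmill_firstThree (mem_center_n11_iff h2') (lie_n11_eq_zero_iff h2')⟩
  · exact ⟨(components_n12 hα).1,
      isWindmill_firstThree (mem_center_n12_iff α) (lie_n12_eq_zero_iff hα)⟩
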